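/- **Theorem 1.5.** Let $d=1$, $\alpha\in(0,1)$, $\varrho\ge 1$, $\beta\in\big(0,\tfrac1{2\varrho}\big)$ and $m>0$. Let $u=u_{\alpha,\varrho}(t,x)$ be the fundamental solution of $$\partial_t^\alpha u(t,x)+(-\Delta)^{\varrho}u(t,x)=u(t,x),\quad t>0,\ x\in\mathbb R,\qquad u(0,\cdot)=\delta_0,$$ where $\partial_t^\alpha f(t)=\frac1{\Gamma(1-\alpha)}\int_0^t\frac{f'(s)}{(t-s)^{\alpha}}\,ds$ is the Caputo derivative, $(-\Delta)^\varrho$ is the fractional Laplacian, i.e. the Fourier multiplier with symbol $|\xi|^{2\varrho}$, and the equation and the initial condition are understood in the sense of tempered distributions in $x$; for each $t>0$ the function $u(t,\cdot)$ is continuous and integrable, with $\sup_{0<t\le T}\|u(t,\cdot)\|_{L^1(\mathbb R)}<\infty$ for every $T>0$. Let $E_\alpha(z)=\sum_{k\ge0}\frac{z^k}{\Gamma(\alpha k+1)}$ be the Mittag-Leffler function, and let $v\in\{-1,1\}$. Then: 1. For every integer $n\ge2$ with $\alpha\ge\frac1n$, $$u_{\alpha,\varrho}(t,mt^\beta v)>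 C\,m^{2\varrho-1}\,t^{\beta(2\varrho-1)-\alpha n}\,E_\alpha(t^\alpha)\,\big(1-o(1)\big)\qquad\text{as }t\to\infty,$$ where $C=\frac{\alpha\,\ell^{2-2\varrho}}{2\varrho}$ and $\ell\in(0,\frac\pi2)$ is the unique solution of $\cos\ell=\ell$. 2. $\displaystyle\lim_{t\to\infty}u_{\alpha,\varrho}(t,mt^\beta v)=\infty.$ -/

import Mathlib

open Set Filter Topology MeasureTheory
open scoped FourierTransform SchwartzMap

noncomputable section

/-- The (one-parameter) Mittag-Leffler function `E_α(z) = ∑ zᵏ / Γ(α k + 1)`; the series converges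
for all real `z` when `α > 0`. -/
def mittagLeffler (α z : ℝ) : ℝ :=
  ∑' k : ℕ, z ^ k / Real.Gamma (α * k + 1)

/-- `HasCaputoDerivAt α f c t`: the Caputo derivative of order `α` of `f`, namely
`Γ(1 - α)⁻¹ ∫₀ᵗ f'(s) (t - s)^(-α) ds`, exists at time `t > 0` and equals `c`.
Here `f` is differentiable on `(0, t)` and the integral converges absolutely; in particular `f'` is
integrable on `(0, t)`. -/
structure HasCaputoDerivAt (α : ℝ) (f : ℝ → ℂ) (c : ℂ) (t : ℝ) : Prop where
  differentiableOn : DifferentiableOn ℝ f (Ioo 0 t)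
  integrable : IntegrableOn (fun s => (t - s) ^ (-α) • deriv f s) (Ioo 0 t)
  eq : (Real.Gamma (1 - α))⁻¹ • ∫ s in Ioo 0 t, (t - s) ^ (-α) • deriv f s = c

/-- The fractional Laplacian `(-Δ)^ϱ` on the real line, acting on Schwartz functions, as the Fourier
multiplier with symbol `|η|^(2ϱ)`, where `η` is the angular frequency. Mathlib's Fourier transform
uses the kernel `exp(-2πi ξ x)`, so that `η = 2πξ`. -/
def fracLaplacian (ϱ : ℝ) (φ : 𝓢(ℝ, ℂ)) (x : ℝ) : ℂ :=
  𝓕⁻ (fun ξ : ℝ => (((2 * Real.pi * |ξ|) ^ (2 * ϱ) : ℝ) : ℂ) * 𝓕 (φ : ℝ → ℂ) ξ) x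

/-- `u = u(t, x)`, `t > 0`, `x ∈ ℝ`, is a fundamental solution of
`∂ₜ^α u + (-Δ)^ϱ u = u`, `u(0, ·) = δ₀`, where `∂ₜ^α` is the Caputo derivative.

The spatial profiles are continuous and integrable, with `L¹` norms bounded on bounded time
intervals. The equation and the initial condition hold in the sense of tempered distributions in the
space variable, that is, after pairing with an arbitrary Schwartz function. -/
structure IsFundamentalSolution (α ϱ : ℝ) (u : ℝ → ℝ → ℝ) : Prop where
  continuous : ∀ t, 0 < t → Continuous (u t)
  integrable : ∀ t, 0 < t → Integrable (u t)
  bounded : ∀ T, 0 < T → ∃ M : ℝ, ∀ t ∈ Ioc 0 T, ∫ x, |u t x| ≤ M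
  equation : ∀ φ : 𝓢(ℝ, ℂ), ∀ t, 0 < t →
    HasCaputoDerivAt α (fun s => ∫ x, (u s x : ℂ) * φ x)
      ((∫ x, (u t x : ℂ) * φ x) - ∫ x, (u t x : ℂ) * fracLaplacian ϱ φ x) t
  initial : ∀ φ : 𝓢(ℝ, ℂ),
    Tendsto (fun t => ∫ x, (u t x : ℂ) * φ x) (𝓝[>] 0) (𝓝 (φ 0))

end

noncomputable section

/-! ### Beta integrals and Riemann-Liouville fractional integrals -/

/-! In frequency the equation becomes, for each `ξ`, a scalar fractional ODE with rate `1 - σ(ξ)`,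
`σ = fracSymbol ϱ`. Pairing with test functions, integrating the Caputo derivative and shrinking
bumps to `ξ` gives a Volterra equation whose only bounded solution is `E_α((1 - σ(ξ)) t^α)`
(`fourierInv_eq`). Inversion then writes `u` as a cosine integral of this function
(`eq_integral_cos`).

`E_α` is nonnegative and increasing on all of `ℝ`, and `E_α(-z) ≤ 1/(1 + z)` for `z ≥ 0`; these
facts come from a minimum principle. So the transform is positive, decreasing in `|ξ|` and
integrable, and `cos ≥ 1/2` for `|ξ| ≤ 1/(2π|x|)`. Inside this lobe, the frequencies with `σ ≤ 1/t`
contribute about `t^(-1/(2ϱ)) E_α(t^α)`, because `E_α(t^α(1 - 1/t))` is comparable to `E_α(t^α)`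
(`exists_mul_mittagLeffler_le`). Outside it, `σ ≥ y = |x|^(-2ϱ)`, and `E_α(t^α(1 - y))` is smaller
than `E_α(t^α)` by any power of `ty` (`exists_mittagLeffler_le`). For `|x| = m t^β` with `β <
1/(2ϱ)`, `ty` is a positive power of `t` up to a constant, so the lobe wins.

The resulting bound `c t^(-1/(2ϱ)) E_α(t^α)` is stronger than the first claim: `αn ≥ 1` puts the
claimed exponent strictly below `-1/(2ϱ)`, so every constant is absorbed. It also gives the second,
since `E_α(t^α)` outgrows every power of `t`. -/

theorem setIntegral_rpow_mul_rpow {a b r t : ℝ} (ha : 0 < a) (hb : 0 < b) (hrt : r < t) :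
    ∫ s in Ioo r t, (t - s) ^ (a - 1) * (s - r) ^ (b - 1) =
      Real.Gamma a * Real.Gamma b / Real.Gamma (a + b) * (t - r) ^ (a + b - 1) := by
  have hT : 0 < t - r := sub_pos.2 hrt
  have h1 := Complex.betaIntegral_scaled (b : ℂ) (a : ℂ) hT
  rw [Complex.betaIntegral_eq_Gamma_mul_div _ _ (by simpa using hb) (by simpa using ha)] at h1
  have h2 : ∫ x in (0 : ℝ)..(t - r), (x : ℂ) ^ ((b : ℂ) - 1) * (((t - r : ℝ) : ℂ) - x) ^ ((a : ℂ) - 1)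
      = ((∫ x in (0 : ℝ)..(t - r), (t - (x + r)) ^ (a - 1) * (x + r - r) ^ (b - 1) : ℝ) : ℂ) := by
    rw [← intervalIntegral.integral_ofReal, intervalIntegral.integral_of_le hT.le,
      intervalIntegral.integral_of_le hT.le]
    refine setIntegral_congr_fun measurableSet_Ioc fun x hx => ?_
    have hx1 : 0 ≤ x := hx.1.le
    have hx2 : 0 ≤ t - r - x := by linarith [hx.2]
    simp only [Complex.ofReal_mul]
    rw [Complex.ofReal_cpow (by linarith), Complex.ofReal_cpow (by linarith), mul_comm]
    push_cast
    ring_nf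
  rw [h2, intervalIntegral.integral_comp_add_right
    (fun s => (t - s) ^ (a - 1) * (s - r) ^ (b - 1))] at h1
  rw [zero_add, sub_add_cancel, intervalIntegral.integral_of_le hrt.le,
    ← integral_Ioc_eq_integral_Ioo.symm] at h1
  have h3 : ((t - r : ℝ) : ℂ) ^ ((b : ℂ) + a - 1) * (Complex.Gamma b * Complex.Gamma a /
      Complex.Gamma (b + a)) = ((Real.Gamma a * Real.Gamma b / Real.Gamma (a + b) *
        (t - r) ^ (a + b - 1) : ℝ) : ℂ) := by
    push_cast
    rw [Complex.ofReal_cpow hT.le, ← Complex.Gamma_ofReal, ← Complex.Gamma_ofReal,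
      ← Complex.Gamma_ofReal]
    push_cast
    rw [add_comm (b : ℂ) a]
    ring
  rw [h3] at h1
  exact_mod_cast h1

theorem integrableOn_rpow_mul_rpow {a b r t : ℝ} (ha : 0 < a) (hb : 0 < b) (hrt : r < t) :
    IntegrableOn (fun s => (t - s) ^ (a - 1) * (s - r) ^ (b - 1)) (Ioo r t) := by
  -- The Bochner integral of a non-integrable function is `0`, so a nonzero value certifies
  -- integrability.
  refine Integrable.of_integral_ne_zero ?_
  rw [setIntegral_rpow_mul_rpow ha hb hrt]
  have := Real.Gamma_pos_of_pos ha
  have := Real.Gamma_pos_of_pos hb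
  have := Real.Gamma_pos_of_pos (add_pos ha hb)
  have := Real.rpow_pos_of_pos (sub_pos.2 hrt) (a + b - 1)
  positivity

theorem integrableOn_sub_rpow {a r t : ℝ} (ha : 0 < a) (hrt : r < t) :
    IntegrableOn (fun s => (t - s) ^ (a - 1)) (Ioo r t) := by
  simpa using integrableOn_rpow_mul_rpow ha one_pos hrt

theorem setIntegral_sub_rpow {a r t : ℝ} (ha : 0 < a) (hrt : r < t) :
    ∫ s in Ioo r t, (t - s) ^ (a - 1) = (t - r) ^ a / a := by
  have h := setIntegral_rpow_mul_rpow ha one_pos hrt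
  have := (Real.Gamma_pos_of_pos ha).ne'
  rw [Real.Gamma_add_one ha.ne'] at h
  simp only [sub_self, Real.rpow_zero, mul_one, Real.Gamma_one, add_sub_cancel_right] at h
  rw [h]
  field_simp

section RL

variable {E : Type*} [NormedAddCommGroup E] [NormedSpace ℝ E]

/-- The Riemann-Liouville integral of order `a`, based at `0`. -/
def rlIntegral (a : ℝ) (f : ℝ → E) (t : ℝ) : E :=
  (Real.Gamma a)⁻¹ • ∫ s in Ioo 0 t, (t - s) ^ (a - 1) • f s

theorem rlIntegral_congr {a t : ℝ} {f g : ℝ → E} (h : ∀ s ∈ Ioo 0 t, f s = g s) :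
    rlIntegral a f t = rlIntegral a g t := by
  unfold rlIntegral
  congr 1
  exact setIntegral_congr_fun measurableSet_Ioo fun s hs => by simp only [h s hs]

theorem integrableOn_sub_rpow_smul {a t : ℝ} (ha : 0 < a) (ht : 0 < t) {f : ℝ → E}
    (hf : Continuous f) : IntegrableOn (fun s => (t - s) ^ (a - 1) • f s) (Ioo 0 t) := by
  obtain ⟨B, hB⟩ := (isCompact_Icc (a := 0) (b := t)).exists_bound_of_continuousOn hf.continuousOn
  refine Integrable.smul_bdd (integrableOn_sub_rpow ha ht) B
    hf.aestronglyMeasurable.restrict ?_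
  filter_upwards [ae_restrict_mem measurableSet_Ioo] with s hs
  exact hB s ⟨hs.1.le, hs.2.le⟩

theorem rlIntegral_const_mul (a c : ℝ) (f : ℝ → ℝ) (t : ℝ) :
    rlIntegral a (fun s => c * f s) t = c * rlIntegral a f t := by
  simp only [rlIntegral, smul_eq_mul]
  rw [mul_left_comm c, ← integral_const_mul c]
  simp only [mul_left_comm c]

theorem rlIntegral_sub {a t : ℝ} {f g : ℝ → E}
    (hf : IntegrableOn (fun s => (t - s) ^ (a - 1) • f s) (Ioo 0 t))
    (hg : IntegrableOn (fun s => (t - s) ^ (a - 1) • g s) (Ioo 0 t)) :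
    rlIntegral a (fun s => f s - g s) t = rlIntegral a f t - rlIntegral a g t := by
  simp only [rlIntegral, smul_sub]
  rw [integral_sub hf hg, smul_sub]

theorem rlIntegral_mono {a t : ℝ} (ha : 0 < a) {f g : ℝ → ℝ}
    (hf : IntegrableOn (fun s => (t - s) ^ (a - 1) • f s) (Ioo 0 t))
    (hg : IntegrableOn (fun s => (t - s) ^ (a - 1) • g s) (Ioo 0 t))
    (h : ∀ s ∈ Ioo 0 t, f s ≤ g s) : rlIntegral a f t ≤ rlIntegral a g t := by
  refine mul_le_mul_of_nonneg_left ?_ (inv_nonneg.2 (Real.Gamma_pos_of_pos ha).le)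
  refine setIntegral_mono_on hf hg measurableSet_Ioo fun s hs => ?_
  have : 0 ≤ t - s := by linarith [hs.2]
  exact mul_le_mul_of_nonneg_left (h s hs) (by positivity)

theorem rlIntegral_rpow {a b t : ℝ} (ha : 0 < a) (hb : -1 < b) (ht : 0 < t) :
    rlIntegral a (fun s => s ^ b) t =
      Real.Gamma (b + 1) / Real.Gamma (a + b + 1) * t ^ (a + b) := by
  have h := setIntegral_rpow_mul_rpow ha (by linarith : 0 < b + 1) ht
  simp only [sub_zero, add_sub_cancel_right, ← add_assoc] at h
  simp only [rlIntegral, smul_eq_mul]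
  have := (Real.Gamma_pos_of_pos ha).ne'
  rw [h]
  field_simp

/-- Fractional integration of order `a` undoes that of order `1 - a` up to an ordinary integral. -/
theorem rlIntegral_rlIntegral_one_sub {a t : ℝ} (ha : a ∈ Ioo (0 : ℝ) 1) {f : ℝ → E}
    (hf : IntegrableOn f (Ioo 0 t)) :
    IntegrableOn (fun s => (t - s) ^ (a - 1) • rlIntegral (1 - a) f s) (Ioo 0 t) ∧
      rlIntegral a (rlIntegral (1 - a) f) t = ∫ s in Ioo 0 t, f s := by
  set μ : Measure ℝ := volume.restrict (Ioo 0 t) with hμ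
  have ha1 : 0 < 1 - a := by linarith [ha.2]
  -- Fubini on the triangle `r < s < t`. The exponents `a` and `1 - a` add up to `1`, so integrating
  -- the kernel in `s` gives the constant `Γ(a) Γ(1 - a)`, whatever `r` is.
  set K : ℝ × ℝ → E := fun p =>
    ({q : ℝ × ℝ | q.2 < q.1}.indicator
      (fun q => (t - q.1) ^ (a - 1) * (q.1 - q.2) ^ ((1 - a) - 1)) p) • f p.2 with hK
  have hmeas : AEStronglyMeasurable K (μ.prod μ) := by
    refine AEStronglyMeasurable.smul ?_ hf.aestronglyMeasurable.comp_snd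
    refine (Measurable.indicator ?_
      (measurableSet_lt measurable_snd measurable_fst)).aestronglyMeasurable
    fun_prop
  have hset : ∀ r ∈ Ioo 0 t, Ioi r ∩ Ioo 0 t = Ioo r t := by
    intro r hr; ext s; simp only [mem_inter_iff, mem_Ioi, mem_Ioo]
    constructor
    · rintro ⟨h1, h2, h3⟩; exact ⟨h1, h3⟩
    · rintro ⟨h1, h2⟩; exact ⟨h1, hr.1.trans h1, h2⟩
  have hKr : ∀ r, (fun s => ({q : ℝ × ℝ | q.2 < q.1}.indicator
      (fun q => (t - q.1) ^ (a - 1) * (q.1 - q.2) ^ ((1 - a) - 1)) (s, r))) =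
      (Ioi r).indicator (fun s => (t - s) ^ (a - 1) * (s - r) ^ ((1 - a) - 1)) := by
    intro r; ext s; simp [indicator]
  have hint1 : ∀ r ∈ Ioo 0 t, Integrable (fun s => ({q : ℝ × ℝ | q.2 < q.1}.indicator
      (fun q => (t - q.1) ^ (a - 1) * (q.1 - q.2) ^ ((1 - a) - 1)) (s, r))) μ := by
    intro r hr
    rw [hKr, integrable_indicator_iff measurableSet_Ioi, IntegrableOn, hμ,
      Measure.restrict_restrict measurableSet_Ioi, hset r hr]
    exact integrableOn_rpow_mul_rpow ha.1 ha1 hr.2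
  have hint2 : ∀ r ∈ Ioo 0 t, ∫ s, ({q : ℝ × ℝ | q.2 < q.1}.indicator
      (fun q => (t - q.1) ^ (a - 1) * (q.1 - q.2) ^ ((1 - a) - 1)) (s, r)) ∂μ =
      Real.Gamma a * Real.Gamma (1 - a) := by
    intro r hr
    rw [hKr, integral_indicator measurableSet_Ioi, hμ,
      Measure.restrict_restrict measurableSet_Ioi, hset r hr,
      setIntegral_rpow_mul_rpow ha.1 ha1 hr.2]
    simp
  have hae : ∀ᵐ r ∂μ, r ∈ Ioo 0 t := ae_restrict_mem measurableSet_Ioo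
  have hint : Integrable K (μ.prod μ) := by
    rw [integrable_prod_iff' hmeas]
    constructor
    · filter_upwards [hae] with r hr
      exact (hint1 r hr).smul_const (f r)
    · refine (hf.norm.const_mul (Real.Gamma a * Real.Gamma (1 - a))).congr ?_
      filter_upwards [hae] with r hr
      rw [← hint2 r hr, ← integral_mul_const]
      refine integral_congr_ae ?_
      filter_upwards [hae] with s hs
      rw [hK, norm_smul, Real.norm_of_nonneg]
      refine indicator_apply_nonneg fun h => ?_
      have h1 : 0 ≤ t - s := by linarith [hs.2]
      have h2 : 0 ≤ s - r := sub_nonneg.2 (le_of_lt h)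
      positivity
  have hinner : ∀ s ∈ Ioo 0 t, ∫ r, K (s, r) ∂μ =
      Real.Gamma (1 - a) • (t - s) ^ (a - 1) • rlIntegral (1 - a) f s := by
    intro s hs
    have e1 : (fun r => K (s, r)) = (Iio s).indicator
        (fun r => (t - s) ^ (a - 1) • (s - r) ^ ((1 - a) - 1) • f r) := by
      ext r
      by_cases h : r < s <;> simp [hK, indicator, h, mul_smul]
    have e2 : Iio s ∩ Ioo 0 t = Ioo 0 s := by
      ext r; simp only [mem_inter_iff, mem_Iio, mem_Ioo]
      constructor
      · rintro ⟨h1, h2, h3⟩; exact ⟨h2, h1⟩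
      · rintro ⟨h1, h2⟩; exact ⟨h2, h1, h2.trans hs.2⟩
    rw [e1, integral_indicator measurableSet_Iio, hμ, Measure.restrict_restrict measurableSet_Iio,
      e2, integral_smul, rlIntegral, smul_comm (Real.Gamma (1 - a)), smul_smul (Real.Gamma (1 - a)),
      mul_inv_cancel₀ (Real.Gamma_pos_of_pos ha1).ne', one_smul]
  have hG := (Real.Gamma_pos_of_pos ha1).ne'
  have hI := hint.integral_prod_left
  have hI2 : IntegrableOn
      (fun s => (t - s) ^ (a - 1) • rlIntegral (1 - a) f s) (Ioo 0 t) := by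
    have hI3 : Integrable (fun s => (Real.Gamma (1 - a))⁻¹ • ∫ r, K (s, r) ∂μ) μ := hI.smul _
    refine hI3.congr ?_
    filter_upwards [hae] with s hs
    rw [hinner s hs, smul_smul, inv_mul_cancel₀ hG, one_smul]
  refine ⟨hI2, ?_⟩
  have hswap := integral_integral_swap (f := fun s r => K (s, r)) hint
  have hL : ∫ s, ∫ r, K (s, r) ∂μ ∂μ = Real.Gamma (1 - a) • ∫ s in Ioo 0 t,
      (t - s) ^ (a - 1) • rlIntegral (1 - a) f s := by
    rw [← integral_smul]
    exact setIntegral_congr_fun measurableSet_Ioo hinner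
  have hR : ∫ r, ∫ s, K (s, r) ∂μ ∂μ = (Real.Gamma a * Real.Gamma (1 - a)) •
      ∫ s in Ioo 0 t, f s := by
    -- In an incomplete space all Bochner integrals are `0` by convention.
    by_cases hE : CompleteSpace E
    · rw [← integral_smul]
      refine setIntegral_congr_fun measurableSet_Ioo fun r hr => ?_
      simp only [hK]
      rw [integral_smul_const, hint2 r hr]
    · simp [integral, hE]
  rw [hL, hR, mul_comm, mul_smul] at hswap
  have h3 := smul_right_injective E hG hswap
  rw [rlIntegral, h3, smul_smul, inv_mul_cancel₀ (Real.Gamma_pos_of_pos ha.1).ne', one_smul]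

end RL

/-! ### Gamma ratios -/

/-- Log-convexity of `Γ` between `x` and `x + 1`. -/
theorem Gamma_add_le_rpow_mul {x s : ℝ} (hx : 0 < x) (hs : s ∈ Ioo (0 : ℝ) 1) :
    Real.Gamma (x + s) ≤ x ^ s * Real.Gamma x := by
  have h := Real.Gamma_mul_add_mul_le_rpow_Gamma_mul_rpow_Gamma hx (by linarith : 0 < x + 1)
    (by linarith [hs.2] : 0 < 1 - s) hs.1 (by ring)
  have hG := Real.Gamma_pos_of_pos hx
  calc Real.Gamma (x + s) = Real.Gamma ((1 - s) * x + s * (x + 1)) := by ring_nf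
    _ ≤ _ := h
    _ = x ^ s * (Real.Gamma x ^ (1 - s) * Real.Gamma x ^ s) := by
      rw [Real.Gamma_add_one hx.ne', Real.mul_rpow hx.le hG.le]; ring
    _ = _ := by rw [← Real.rpow_add hG]; simp

/-- The upper bound for `Γ`, applied from `x + s` to `x + 1`, turns into a lower bound for `Γ(x +
s)`; the factor `2` pays for replacing `x + s` by `x`. -/
theorem rpow_mul_Gamma_le {x s : ℝ} (hx : 1 ≤ x) (hs : s ∈ Ioo (0 : ℝ) 1) :
    x ^ s * Real.Gamma x ≤ 2 * Real.Gamma (x + s) := by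
  have hx0 : 0 < x := by linarith
  have hxs : 0 < x + s := by linarith [hs.1]
  have h := Gamma_add_le_rpow_mul hxs (s := 1 - s) ⟨by linarith [hs.2], by linarith [hs.1]⟩
  rw [show x + s + (1 - s) = x + 1 by ring, Real.Gamma_add_one hx0.ne'] at h
  have hG := Real.Gamma_pos_of_pos hx0
  have hG2 := Real.Gamma_pos_of_pos hxs
  have h1 : (x + s) ^ (1 - s) ≤ 2 * x ^ (1 - s) := by
    calc (x + s) ^ (1 - s) ≤ (2 * x) ^ (1 - s) :=
          Real.rpow_le_rpow hxs.le (by linarith [hs.2]) (by linarith [hs.2])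
      _ = 2 ^ (1 - s) * x ^ (1 - s) := Real.mul_rpow (by norm_num) hx0.le
      _ ≤ 2 ^ (1 : ℝ) * x ^ (1 - s) := by
          gcongr
          · norm_num
          · linarith [hs.1]
      _ = _ := by simp
  have h2 : x * Real.Gamma x ≤ 2 * x ^ (1 - s) * Real.Gamma (x + s) :=
    h.trans (by gcongr)
  have h3 : x = x ^ s * x ^ (1 - s) := by rw [← Real.rpow_add hx0]; simp
  have h4 : 0 < x ^ (1 - s) := Real.rpow_pos_of_pos hx0 _
  have h5 : x ^ (1 - s) * (x ^ s * Real.Gamma x) ≤ x ^ (1 - s) * (2 * Real.Gamma (x + s)) := by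
    calc _ = (x ^ s * x ^ (1 - s)) * Real.Gamma x := by ring
      _ = x * Real.Gamma x := by rw [← h3]
      _ ≤ _ := h2
      _ = _ := by ring
  exact le_of_mul_le_mul_left h5 h4

theorem Gamma_add_mul_nat_le {x s : ℝ} (hx : 0 < x) (hs : s ∈ Ioo (0 : ℝ) 1) (q : ℕ) :
    Real.Gamma (x + s * q) ≤ (x + s * q) ^ (s * q) * Real.Gamma x := by
  induction q with
  | zero => simp
  | succ q ih =>
    have hq : 0 < x + s * q := by have := hs.1; positivity
    have hG := Real.Gamma_pos_of_pos hx
    have h0 := hs.1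
    push_cast
    calc Real.Gamma (x + s * (q + 1)) = Real.Gamma (x + s * q + s) := by ring_nf
      _ ≤ (x + s * q) ^ s * Real.Gamma (x + s * q) := Gamma_add_le_rpow_mul hq hs
      _ ≤ (x + s * q) ^ s * ((x + s * q) ^ (s * q) * Real.Gamma x) := by gcongr
      _ = (x + s * q) ^ (s * (q + 1)) * Real.Gamma x := by
        rw [← mul_assoc, ← Real.rpow_add hq]; ring_nf
      _ ≤ (x + s * (q + 1)) ^ (s * (q + 1)) * Real.Gamma x := by
        gcongr
        linarith

/-! ### The Mittag-Leffler function -/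

theorem Gamma_mul_nat_add_one_pos {α : ℝ} (hα : 0 < α) (k : ℕ) : 0 < Real.Gamma (α * k + 1) :=
  Real.Gamma_pos_of_pos (by positivity)

/-- Consecutive coefficients have ratio at most `2 (αk + 1)^(-α)`. This yields both the summability
of the series and its infinite radius of convergence. -/
theorem tendsto_Gamma_ratio {α : ℝ} (hα : α ∈ Ioo (0 : ℝ) 1) :
    Tendsto (fun k : ℕ => (Real.Gamma (α * (k + 1 : ℕ) + 1))⁻¹ / (Real.Gamma (α * k + 1))⁻¹)
      atTop (𝓝 0) := by
  have h0 := hα.1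
  have hlim : Tendsto (fun k : ℕ => 2 * (α * k + 1) ^ (-α)) atTop (𝓝 0) := by
    rw [← mul_zero (2 : ℝ)]
    refine ((tendsto_rpow_neg_atTop h0).comp ?_).const_mul 2
    exact tendsto_atTop_add_const_right _ _
      ((tendsto_natCast_atTop_atTop (R := ℝ)).const_mul_atTop h0)
  refine squeeze_zero (fun k => ?_) (fun k => ?_) hlim
  · have := Gamma_mul_nat_add_one_pos h0 k
    have := Gamma_mul_nat_add_one_pos h0 (k + 1)
    positivity
  · have h1 := Gamma_mul_nat_add_one_pos h0 k
    have h2 := Gamma_mul_nat_add_one_pos h0 (k + 1)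
    have hx : 1 ≤ α * k + 1 := by
      have : 0 ≤ α * k := by positivity
      linarith
    have h := rpow_mul_Gamma_le hx hα
    rw [show α * (k : ℝ) + 1 + α = α * (k + 1 : ℕ) + 1 by push_cast; ring] at h
    rw [div_inv_eq_mul, Real.rpow_neg (by linarith), inv_mul_eq_div, div_le_iff₀ h2,
      ← div_eq_mul_inv, div_mul_eq_mul_div, le_div_iff₀ (by positivity)]
    linarith

theorem summable_mittagLeffler {α : ℝ} (hα : α ∈ Ioo (0 : ℝ) 1) (z : ℝ) :
    Summable (fun k : ℕ => z ^ k / Real.Gamma (α * k + 1)) := by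
  rcases eq_or_ne z 0 with rfl | hz
  · refine summable_of_ne_finset_zero (s := {0}) fun k hk => ?_
    rw [zero_pow (by simpa using hk), zero_div]
  refine summable_of_ratio_test_tendsto_lt_one (l := 0) one_pos
    (Eventually.of_forall fun k => ?_) ?_
  · have := Gamma_mul_nat_add_one_pos hα.1 k
    positivity
  · have h := (tendsto_Gamma_ratio hα).const_mul |z|
    rw [mul_zero] at h
    refine h.congr fun k => ?_
    have h1 := Gamma_mul_nat_add_one_pos hα.1 k
    have h2 := Gamma_mul_nat_add_one_pos hα.1 (k + 1)
    rw [norm_div, norm_div, norm_pow, norm_pow, Real.norm_of_nonneg h1.le,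
      Real.norm_of_nonneg h2.le, Real.norm_eq_abs, pow_succ]
    have : |z| ≠ 0 := abs_ne_zero.2 hz
    field_simp

theorem differentiable_mittagLeffler {α : ℝ} (hα : α ∈ Ioo (0 : ℝ) 1) :
    Differentiable ℝ (mittagLeffler α) := by
  set c : ℕ → ℝ := fun k => (Real.Gamma (α * k + 1))⁻¹ with hc
  have hpos : ∀ k, 0 < c k := fun k => inv_pos.2 (Gamma_mul_nat_add_one_pos hα.1 k)
  have hr : (FormalMultilinearSeries.ofScalars ℝ c).radius = ⊤ := by
    refine FormalMultilinearSeries.ofScalars_radius_eq_top_of_tendsto ℝ c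
      (Eventually.of_forall fun k => (hpos k).ne') ?_
    simp only [Real.norm_of_nonneg (hpos _).le]
    exact tendsto_Gamma_ratio hα
  have hf := (FormalMultilinearSeries.ofScalars ℝ c).hasFPowerSeriesOnBall (by simp [hr])
  rw [hr] at hf
  have hd := hf.differentiableOn
  have he : mittagLeffler α = FormalMultilinearSeries.ofScalarsSum c := by
    ext z
    rw [FormalMultilinearSeries.ofScalars_sum_eq, mittagLeffler]
    refine tsum_congr fun k => ?_
    simp [hc, div_eq_inv_mul]
  rw [he]
  intro x
  exact (hd x (by simp)).differentiableAt (by simp)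

theorem continuous_mittagLeffler_mul_rpow {α : ℝ} (hα : α ∈ Ioo (0 : ℝ) 1) (c : ℝ) :
    Continuous fun s : ℝ => mittagLeffler α (c * s ^ α) :=
  (differentiable_mittagLeffler hα).continuous.comp
    (continuous_const.mul (Real.continuous_rpow_const hα.1.le))

theorem mittagLeffler_zero (α : ℝ) : mittagLeffler α 0 = 1 := by
  rw [mittagLeffler, tsum_eq_single 0]
  · simp
  · intro k hk
    simp [hk]

theorem pow_div_Gamma_le_mittagLeffler {α z : ℝ} (hα : α ∈ Ioo (0 : ℝ) 1) (hz : 0 ≤ z) (q : ℕ) :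
    z ^ q / Real.Gamma (α * q + 1) ≤ mittagLeffler α z :=
  (summable_mittagLeffler hα z).le_tsum q fun k _ => by
    have := Gamma_mul_nat_add_one_pos hα.1 k
    positivity

theorem one_le_mittagLeffler {α z : ℝ} (hα : α ∈ Ioo (0 : ℝ) 1) (hz : 0 ≤ z) :
    1 ≤ mittagLeffler α z := by
  simpa using pow_div_Gamma_le_mittagLeffler hα hz 0

theorem monotoneOn_mittagLeffler_Ici {α : ℝ} (hα : α ∈ Ioo (0 : ℝ) 1) :
    MonotoneOn (mittagLeffler α) (Ici 0) := by
  intro z hz w _ hzw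
  refine (summable_mittagLeffler hα z).tsum_le_tsum (fun k => ?_) (summable_mittagLeffler hα w)
  have := Gamma_mul_nat_add_one_pos hα.1 k
  have hz' : 0 ≤ z := hz
  gcongr

theorem mul_rpow_pow {t : ℝ} (ht : 0 ≤ t) (α c : ℝ) (k : ℕ) :
    (c * t ^ α) ^ k = c ^ k * t ^ (α * k) := by
  rw [mul_pow, ← Real.rpow_natCast (t ^ α), ← Real.rpow_mul ht]

/-- `t ↦ E_α(c t^α)` solves the Volterra form of `∂ₜ^α y = c y`, `y(0) = 1`. -/
theorem mittagLeffler_volterra {α : ℝ} (hα : α ∈ Ioo (0 : ℝ) 1) (c : ℝ) {t : ℝ} (ht : 0 < t) :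
    mittagLeffler α (c * t ^ α) =
      1 + c * rlIntegral α (fun s => mittagLeffler α (c * s ^ α)) t := by
  have h0 := hα.1
  have hGα := Real.Gamma_pos_of_pos h0
  -- The series is integrated term by term; the beta integral turns the `k`-th monomial into the
  -- next one.
  set G : ℕ → ℝ → ℝ := fun k s => c ^ k / Real.Gamma (α * k + 1) *
    ((t - s) ^ (α - 1) * s ^ (α * k)) with hG
  have hbeta : ∀ k : ℕ, ∫ s in Ioo 0 t, (t - s) ^ (α - 1) * s ^ (α * k) =
      Real.Gamma α * Real.Gamma (α * k + 1) / Real.Gamma (α * (k + 1 : ℕ) + 1) *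
        t ^ (α * (k + 1 : ℕ)) := by
    intro k
    have h := setIntegral_rpow_mul_rpow h0 (b := α * k + 1) (by positivity) ht
    simp only [sub_zero, add_sub_cancel_right] at h
    rw [h]
    push_cast
    ring_nf
  have hbint : ∀ k : ℕ, IntegrableOn (fun s => (t - s) ^ (α - 1) * s ^ (α * k)) (Ioo 0 t) := by
    intro k
    have h := integrableOn_rpow_mul_rpow h0 (b := α * k + 1) (by positivity) ht
    simpa using h
  have hsumabs := (summable_nat_add_iff 1).2 (summable_mittagLeffler hα (|c| * t ^ α))
  have hsum := (summable_nat_add_iff 1).2 (summable_mittagLeffler hα (c * t ^ α))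
  have key := hasSum_integral_of_summable_integral_norm (F := G) (μ := volume.restrict (Ioo 0 t))
    (fun k => (hbint k).const_mul _) (by
      rcases eq_or_ne c 0 with rfl | hc
      · refine summable_of_ne_finset_zero (s := {0}) fun k hk => ?_
        simp [hG, zero_pow (show k ≠ 0 by simpa using hk)]
      have hc' : |c| ≠ 0 := abs_ne_zero.2 hc
      refine (hsumabs.mul_left (Real.Gamma α * |c|⁻¹)).congr fun k => ?_
      have h1 := Gamma_mul_nat_add_one_pos h0 k
      have e : ∫ s in Ioo 0 t, ‖G k s‖ = |c| ^ k / Real.Gamma (α * k + 1) *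
          ∫ s in Ioo 0 t, (t - s) ^ (α - 1) * s ^ (α * k) := by
        rw [← integral_const_mul]
        refine setIntegral_congr_fun measurableSet_Ioo fun s hs => ?_
        have hs1 : 0 ≤ t - s := by linarith [hs.2]
        have hs2 := hs.1.le
        simp only [hG]
        rw [norm_mul, norm_div, norm_pow, Real.norm_of_nonneg h1.le, Real.norm_eq_abs,
          Real.norm_of_nonneg (by positivity)]
      rw [e, hbeta, mul_rpow_pow ht.le, pow_succ]
      field_simp)
  have hval : ∫ s in Ioo 0 t, ∑' k, G k s =
      ∫ s in Ioo 0 t, (t - s) ^ (α - 1) * mittagLeffler α (c * s ^ α) := by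
    refine setIntegral_congr_fun measurableSet_Ioo fun s hs => ?_
    simp only [mittagLeffler]
    rw [← tsum_mul_left]
    refine tsum_congr fun k => ?_
    rw [mul_rpow_pow hs.1.le]
    simp only [hG]
    ring
  have hterm : ∀ k : ℕ, c * ((Real.Gamma α)⁻¹ * ∫ s in Ioo 0 t, G k s) =
      (c * t ^ α) ^ (k + 1) / Real.Gamma (α * (k + 1 : ℕ) + 1) := by
    intro k
    have h1 := Gamma_mul_nat_add_one_pos h0 k
    simp only [hG]
    rw [integral_const_mul, hbeta, mul_rpow_pow ht.le, pow_succ]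
    field_simp
  have htot : c * rlIntegral α (fun s => mittagLeffler α (c * s ^ α)) t =
      ∑' k : ℕ, (c * t ^ α) ^ (k + 1) / Real.Gamma (α * (k + 1 : ℕ) + 1) := by
    simp only [rlIntegral, smul_eq_mul]
    rw [← hval, ← key.tsum_eq, ← tsum_mul_left, ← tsum_mul_left]
    exact tsum_congr hterm
  rw [htot, mittagLeffler, (summable_mittagLeffler hα _).tsum_eq_zero_add]
  simp

/-- A bounded solution of the Volterra equation is given by the Mittag-Leffler function. -/
theorem eq_mittagLeffler_of_volterra {α : ℝ} (hα : α ∈ Ioo (0 : ℝ) 1) {c M T : ℝ} {y : ℝ → ℂ}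
    (hint : ∀ t ∈ Ioc 0 T, IntegrableOn (fun s => (t - s) ^ (α - 1) • y s) (Ioo 0 t))
    (heq : ∀ t ∈ Ioc 0 T, y t = 1 + c • rlIntegral α y t)
    (hbd : ∀ t ∈ Ioc 0 T, ‖y t‖ ≤ M) {t : ℝ} (ht : t ∈ Ioc 0 T) :
    y t = (mittagLeffler α (c * t ^ α) : ℂ) := by
  have h0 := hα.1
  have hM : 0 ≤ M := (norm_nonneg _).trans (hbd t ht)
  have hGα := Real.Gamma_pos_of_pos h0
  have hcont := continuous_mittagLeffler_mul_rpow hα c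
  have hFint : ∀ t, 0 < t →
      IntegrableOn (fun s => (t - s) ^ (α - 1) • (mittagLeffler α (c * s ^ α) : ℂ)) (Ioo 0 t) :=
    fun t ht => integrableOn_sub_rpow_smul h0 ht (Complex.continuous_ofReal.comp hcont)
  set w : ℝ → ℂ := fun s => y s - (mittagLeffler α (c * s ^ α) : ℂ) with hw
  have hweq : ∀ t ∈ Ioc 0 T, w t = c • rlIntegral α w t := by
    intro t ht
    have e1 : rlIntegral α (fun s => (mittagLeffler α (c * s ^ α) : ℂ)) t =
        ((rlIntegral α (fun s => mittagLeffler α (c * s ^ α)) t : ℝ) : ℂ) := by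
      simp only [rlIntegral, Complex.real_smul, smul_eq_mul, Complex.ofReal_mul]
      rw [← integral_complex_ofReal]
      simp
    have e2 : rlIntegral α w t = rlIntegral α y t -
        rlIntegral α (fun s => (mittagLeffler α (c * s ^ α) : ℂ)) t :=
      rlIntegral_sub (hint t ht) (hFint t ht.1)
    rw [e2, e1]
    simp only [hw]
    rw [heq t ht, mittagLeffler_volterra hα c ht.1]
    simp only [Complex.real_smul]
    push_cast
    ring
  obtain ⟨B, hB⟩ := (isCompact_Icc (a := 0) (b := T)).exists_bound_of_continuousOn
    hcont.continuousOn
  -- Picard iteration: each use of `w = c • rlIntegral α w` improves the bound to the next term of a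
  -- convergent series, so `w = 0`.
  have hbound : ∀ n : ℕ, ∀ t ∈ Ioc 0 T,
      ‖w t‖ ≤ (M + B) * ((|c| * t ^ α) ^ n / Real.Gamma (α * n + 1)) := by
    intro n
    induction n with
    | zero =>
      intro t ht
      have h1 := hbd t ht
      have h2 := hB t ⟨ht.1.le, ht.2⟩
      have h3 := norm_sub_le (y t) (mittagLeffler α (c * t ^ α) : ℂ)
      rw [Complex.norm_real] at h3
      simp only [pow_zero, Nat.cast_zero, mul_zero, zero_add, Real.Gamma_one, div_one, mul_one]
      linarith
    | succ n ih =>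
      intro t ht
      have hMB : 0 ≤ M + B := by
        have := (norm_nonneg _).trans (hB t ⟨ht.1.le, ht.2⟩)
        linarith
      have hGn := Gamma_mul_nat_add_one_pos h0 n
      have hb := integrableOn_rpow_mul_rpow h0 (b := α * n + 1) (by positivity) ht.1
      have hb2 := setIntegral_rpow_mul_rpow h0 (b := α * n + 1) (by positivity) ht.1
      simp only [sub_zero, add_sub_cancel_right] at hb hb2
      rw [hweq t ht, rlIntegral, norm_smul, norm_smul, Real.norm_of_nonneg (inv_nonneg.2 hGα.le),
        Real.norm_eq_abs]
      have hle : ‖∫ s in Ioo 0 t, (t - s) ^ (α - 1) • w s‖ ≤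
          ∫ s in Ioo 0 t, (M + B) * (|c| ^ n / Real.Gamma (α * n + 1)) *
            ((t - s) ^ (α - 1) * s ^ (α * n)) := by
        refine norm_integral_le_of_norm_le (hb.const_mul _) ?_
        filter_upwards [ae_restrict_mem measurableSet_Ioo] with s hs
        have hs1 : 0 ≤ t - s := by linarith [hs.2]
        have h := ih s ⟨hs.1, hs.2.le.trans ht.2⟩
        rw [mul_rpow_pow hs.1.le] at h
        rw [norm_smul, Real.norm_of_nonneg (by positivity)]
        calc _ ≤ (t - s) ^ (α - 1) * _ := mul_le_mul_of_nonneg_left h (by positivity)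
          _ = _ := by ring
      rw [integral_const_mul, hb2] at hle
      refine (mul_le_mul_of_nonneg_left (mul_le_mul_of_nonneg_left hle (inv_nonneg.2 hGα.le))
        (abs_nonneg c)).trans_eq ?_
      rw [mul_rpow_pow ht.1.le, show α + (α * n + 1) - 1 = α * (n + 1 : ℕ) by push_cast; ring,
        show α + (α * n + 1) = α * (n + 1 : ℕ) + 1 by push_cast; ring, pow_succ]
      field_simp
  have hlim := ((summable_mittagLeffler hα (|c| * t ^ α)).tendsto_atTop_zero).const_mul (M + B)
  rw [mul_zero] at hlim
  have hw0 : ‖w t‖ ≤ 0 := ge_of_tendsto' hlim fun n => hbound n t ht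
  exact sub_eq_zero.1 (norm_le_zero_iff.1 hw0)

/-! ### Ratios of Mittag-Leffler values -/

/-- The terms of `E_α(t^α)` with `k` up to a multiple of `t` carry the sum, and there `(1 - 1/t)^k`
is bounded below; later terms at least halve at each step. -/
theorem exists_mul_mittagLeffler_le {α : ℝ} (hα : α ∈ Ioo (0 : ℝ) 1) :
    ∃ c : ℝ, 0 < c ∧ ∀ t : ℝ, 2 ≤ t →
      c * mittagLeffler α (t ^ α) ≤ mittagLeffler α (t ^ α * (1 - 1 / t)) := by
  have h0 := hα.1
  -- Since `R^α = 4`, the term ratio `2 t^α / (αk + 1)^α` is at most `1/2` once `αk + 1 > Rt`.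
  set R : ℝ := 4 ^ (1 / α) with hR
  have hRpos : 0 < R := by positivity
  have hRα : R ^ α = 4 := by
    rw [hR, ← Real.rpow_mul (by norm_num), one_div_mul_cancel h0.ne', Real.rpow_one]
  set A : ℝ := Real.exp (-(2 * (R / α + 1))) with hA
  have hA0 : 0 < A := Real.exp_pos _
  have hA1 : A ≤ 1 := Real.exp_le_one_iff.2 (by
    have : 0 ≤ R / α := by positivity
    linarith)
  refine ⟨A / 2, by positivity, fun t ht => ?_⟩
  have ht0 : 0 < t := by linarith
  set p : ℝ := 1 - 1 / t with hp
  have hx : 1 / t ≤ 1 / 2 := one_div_le_one_div_of_le (by norm_num) ht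
  have hx0 : 0 < 1 / t := by positivity
  have hp0 : 0 ≤ p := by rw [hp]; linarith
  have hp1 : p ≤ 1 := by rw [hp]; linarith
  have hpe : Real.exp (-(2 / t)) ≤ p := by
    rw [Real.exp_neg, inv_le_iff_one_le_mul₀ (Real.exp_pos _)]
    have := Real.add_one_le_exp (2 / t)
    have e : 2 / t = 2 * (1 / t) := by ring
    calc (1 : ℝ) ≤ p * (2 / t + 1) := by rw [e, hp]; nlinarith
      _ ≤ _ := by gcongr
  set a : ℕ → ℝ := fun k => (t ^ α) ^ k / Real.Gamma (α * k + 1) with ha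
  have hapos : ∀ k, 0 < a k := fun k => by
    have := Gamma_mul_nat_add_one_pos h0 k
    simp only [ha]
    positivity
  have hsum : Summable a := summable_mittagLeffler hα _
  have hstep : ∀ k : ℕ, a (k + 1) * (α * k + 1) ^ α ≤ 2 * t ^ α * a k := by
    intro k
    have h1 := Gamma_mul_nat_add_one_pos h0 k
    have h2 := Gamma_mul_nat_add_one_pos h0 (k + 1)
    have hx : 1 ≤ α * k + 1 := by
      have : 0 ≤ α * k := by positivity
      linarith
    have h := rpow_mul_Gamma_le hx hα
    rw [show α * (k : ℝ) + 1 + α = α * (k + 1 : ℕ) + 1 by push_cast; ring] at h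
    simp only [ha]
    rw [div_mul_eq_mul_div, mul_div_assoc', div_le_div_iff₀ h2 h1, pow_succ]
    calc _ = (t ^ α) ^ k * t ^ α * ((α * k + 1) ^ α * Real.Gamma (α * k + 1)) := by ring
      _ ≤ (t ^ α) ^ k * t ^ α * (2 * Real.Gamma (α * (k + 1 : ℕ) + 1)) := by gcongr
      _ = _ := by ring
  -- Subtracting `a k / 2` makes one inequality cover both ranges: in the tail the left side is
  -- nonpositive. With `S`, `P` the two full sums, summation gives `A (S/2 - 1) ≤ P - 1`, and `A ≤
  -- 1` finishes.
  have hpoint : ∀ k : ℕ, A * (a (k + 1) - a k / 2) ≤ a (k + 1) * p ^ (k + 1) := by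
    intro k
    have hak := hapos k
    have hak1 := hapos (k + 1)
    by_cases hk : α * k + 1 ≤ R * t
    · have hkt : (k + 1 : ℝ) ≤ (R / α + 1) * t := by
        have : (k : ℝ) ≤ R / α * t := by
          rw [div_mul_eq_mul_div, le_div_iff₀ h0]; linarith
        linarith
      have hpk : A ≤ p ^ (k + 1) := by
        calc A ≤ Real.exp (-(2 / t)) ^ (k + 1) := by
              rw [← Real.exp_nat_mul, hA, Real.exp_le_exp]
              push_cast
              have : (k + 1 : ℝ) * (2 / t) ≤ (R / α + 1) * t * (2 / t) := by gcongr
              have e : (R / α + 1) * t * (2 / t) = 2 * (R / α + 1) := by field_simp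
              linarith
          _ ≤ _ := by gcongr
      calc A * (a (k + 1) - a k / 2) ≤ A * a (k + 1) := by gcongr; linarith
        _ ≤ p ^ (k + 1) * a (k + 1) := by gcongr
        _ = _ := mul_comm _ _
    · have h1 : 4 * t ^ α ≤ (α * k + 1) ^ α := by
        rw [← hRα, ← Real.mul_rpow hRpos.le ht0.le]
        exact Real.rpow_le_rpow (by positivity) (not_le.1 hk).le h0.le
      have h2 : a (k + 1) * (4 * t ^ α) ≤ 2 * t ^ α * a k :=
        (mul_le_mul_of_nonneg_left h1 hak1.le).trans (hstep k)
      have htα : 0 < t ^ α := by positivity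
      have h3 : a (k + 1) ≤ a k / 2 := by
        have : t ^ α * (4 * a (k + 1)) ≤ t ^ α * (2 * a k) := by linarith
        have := le_of_mul_le_mul_left this htα
        linarith
      have h4 : A * (a (k + 1) - a k / 2) ≤ 0 :=
        mul_nonpos_of_nonneg_of_nonpos hA0.le (by linarith)
      exact h4.trans (by positivity)
  have hsum' : Summable fun k => a k * p ^ k := by
    refine (summable_mittagLeffler hα (t ^ α * p)).congr fun k => ?_
    simp only [ha]; rw [mul_pow]; ring
  have hS : mittagLeffler α (t ^ α) = ∑' k, a k := rfl
  have hP : mittagLeffler α (t ^ α * p) = ∑' k, a k * p ^ k :=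
    tsum_congr fun k => by simp only [ha]; rw [mul_pow]; ring
  have ha0 : a 0 = 1 := by simp [ha]
  have hs1 := (summable_nat_add_iff 1).2 hsum
  have hs2 := (summable_nat_add_iff 1).2 hsum'
  have hle := ((hs1.sub (hsum.div_const 2)).mul_left A).tsum_le_tsum hpoint hs2
  rw [tsum_mul_left, hs1.tsum_sub (hsum.div_const 2), tsum_div_const] at hle
  have e1 := hsum.tsum_eq_zero_add
  have e2 := hsum'.tsum_eq_zero_add
  rw [pow_zero, ha0, mul_one] at e2
  rw [ha0] at e1
  rw [hS, hP, e2]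
  have e3 : ∑' k, a (k + 1) = (∑' k, a k) - 1 := by linarith
  rw [e3] at hle
  linarith

/-- Comparing the `k`-th term on the left with the `(k + q)`-th on the right gains `t^(-αq)` and
costs a Gamma ratio of size `(α(k + q) + 1)^(αq)`. The damping `(1 - y)^k` absorbs that power at the
price of `y^(-αq)`. -/
theorem exists_mittagLeffler_le {α : ℝ} (hα : α ∈ Ioo (0 : ℝ) 1) (q : ℕ) :
    ∃ C : ℝ, 0 < C ∧ ∀ t : ℝ, 0 < t → ∀ y ∈ Ioc (0 : ℝ) 1,
      mittagLeffler α (t ^ α * (1 - y)) ≤ C * (t * y) ^ (-(α * q)) * mittagLeffler α (t ^ α) := by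
  have h0 := hα.1
  -- With `v = y(k + 1 + q)`: `e^(1+q)` pays for replacing `e^(-ky)` by `e^(-v)` (as `y ≤ 1`), and
  -- `1 + q!` for `v^(αq) ≤ (1 + q!) e^v`.
  refine ⟨Real.exp (1 + q) * (1 + q.factorial), by positivity, fun t ht y hy => ?_⟩
  have hy0 := hy.1
  have hy1 : 0 ≤ 1 - y := by linarith [hy.2]
  set C : ℝ := Real.exp (1 + q) * (1 + q.factorial) with hC
  have hCpos : 0 < C := by positivity
  have hpow : ∀ k : ℕ, (1 - y) ^ k * (y * (α * k + 1 + α * q)) ^ (α * q) ≤ C := by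
    intro k
    set v : ℝ := y * (k + 1 + q) with hv
    have hv0 : 0 ≤ v := by positivity
    have h1 : (y * (α * k + 1 + α * q)) ^ (α * q) ≤ v ^ (α * q) := by
      refine Real.rpow_le_rpow (by positivity) ?_ (by positivity)
      rw [hv]
      have : α * k ≤ 1 * k := by gcongr; exact hα.2.le
      have : α * q ≤ 1 * q := by gcongr; exact hα.2.le
      gcongr <;> linarith
    have h2 : v ^ (α * q) ≤ (1 + q.factorial) * Real.exp v := by
      rcases le_total v 1 with hv1 | hv1
      · have : v ^ (α * q) ≤ 1 := Real.rpow_le_one hv0 hv1 (by positivity)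
        have h3 := Real.one_le_exp hv0
        have h4 : (1 : ℝ) ≤ 1 + q.factorial := by
          have : (0 : ℝ) ≤ q.factorial := by positivity
          linarith
        nlinarith
      · have h3 : v ^ (α * q) ≤ v ^ (q : ℝ) := by
          refine Real.rpow_le_rpow_of_exponent_le hv1 ?_
          have : α * q ≤ 1 * q := by gcongr; exact hα.2.le
          linarith
        rw [Real.rpow_natCast] at h3
        have h4 := Real.pow_div_factorial_le_exp v hv0 q
        rw [div_le_iff₀ (by positivity)] at h4
        have := Real.exp_pos v
        linarith
    have h3 : (1 - y) ^ k ≤ Real.exp (1 + q) * Real.exp (-v) := by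
      have : 1 - y ≤ Real.exp (-y) := by
        have := Real.add_one_le_exp (-y); linarith
      calc (1 - y) ^ k ≤ Real.exp (-y) ^ k := by gcongr
        _ = Real.exp (k * (-y)) := by rw [Real.exp_nat_mul]
        _ ≤ Real.exp (1 + q + (-v)) := by
          rw [Real.exp_le_exp, hv]
          have : y * (1 + q) ≤ 1 * (1 + q) := by gcongr; exact hy.2
          linarith
        _ = _ := Real.exp_add _ _
    calc _ ≤ (Real.exp (1 + q) * Real.exp (-v)) * ((1 + q.factorial) * Real.exp v) := by
          gcongr
          exact h1.trans h2
      _ = C * (Real.exp (-v) * Real.exp v) := by rw [hC]; ring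
      _ = C := by rw [← Real.exp_add]; simp
  have hterm : ∀ k : ℕ, (t ^ α * (1 - y)) ^ k / Real.Gamma (α * k + 1) ≤
      C * (t * y) ^ (-(α * q)) * ((t ^ α) ^ (k + q) / Real.Gamma (α * (k + q : ℕ) + 1)) := by
    intro k
    have h1 := Gamma_mul_nat_add_one_pos h0 k
    have h2 := Gamma_mul_nat_add_one_pos h0 (k + q)
    have hg := Gamma_add_mul_nat_le (x := α * k + 1) (by positivity) hα q
    rw [show α * (k : ℝ) + 1 + α * q = α * (k + q : ℕ) + 1 by push_cast; ring] at hg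
    have hpk := hpow k
    rw [show α * (k : ℝ) + 1 + α * q = α * (k + q : ℕ) + 1 by push_cast; ring,
      Real.mul_rpow hy0.le (by positivity)] at hpk
    have hyq : 0 < y ^ (α * q) := by positivity
    have htq : (t ^ α) ^ (k + q) = (t ^ α) ^ k * t ^ (α * q) := by
      rw [pow_add, ← Real.rpow_natCast (t ^ α) q, ← Real.rpow_mul ht.le]
    rw [Real.rpow_neg (by positivity), Real.mul_rpow ht.le hy0.le, htq, mul_pow]
    rw [div_le_iff₀ h1]
    have htq0 : 0 < t ^ (α * q) := by positivity
    have e : C * (t ^ (α * q) * y ^ (α * q))⁻¹ * ((t ^ α) ^ k * t ^ (α * q) /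
        Real.Gamma (α * (k + q : ℕ) + 1)) * Real.Gamma (α * k + 1) =
        (t ^ α) ^ k * (C * Real.Gamma (α * k + 1) /
          (y ^ (α * q) * Real.Gamma (α * (k + q : ℕ) + 1))) := by
      field_simp
    rw [e]
    gcongr
    rw [le_div_iff₀ (by positivity)]
    calc _ ≤ (1 - y) ^ k * (y ^ (α * q) * ((α * (k + q : ℕ) + 1) ^ (α * q) *
          Real.Gamma (α * k + 1))) := by gcongr
      _ = ((1 - y) ^ k * (y ^ (α * q) * (α * (k + q : ℕ) + 1) ^ (α * q))) *
          Real.Gamma (α * k + 1) := by ring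
      _ ≤ _ := by gcongr
  have hsum := summable_mittagLeffler hα (t ^ α)
  have hs := (summable_nat_add_iff q).2 hsum
  calc mittagLeffler α (t ^ α * (1 - y)) ≤ _ :=
        (summable_mittagLeffler hα _).tsum_le_tsum hterm (hs.mul_left _)
    _ = C * (t * y) ^ (-(α * q)) * _ := tsum_mul_left
    _ ≤ _ := by
      gcongr
      rw [mittagLeffler, ← hsum.sum_add_tsum_nat_add q]
      have : 0 ≤ ∑ k ∈ Finset.range q, (t ^ α) ^ k / Real.Gamma (α * k + 1) :=
        Finset.sum_nonneg fun k _ => by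
          have := Gamma_mul_nat_add_one_pos h0 k
          positivity
      linarith

/-! ### A minimum principle, and the Mittag-Leffler function on the negative half-line -/

theorem rpow_sub_rpow_ge {p t h : ℝ} (hp : p ∈ Icc (0 : ℝ) 1) (ht : 0 < t) (hh : h ≤ t) :
    p * h * t ^ (p - 1) ≤ t ^ p - (t - h) ^ p := by
  have h1 : -1 ≤ -(h / t) := by
    rw [neg_le_neg_iff, div_le_one ht]; exact hh
  have h2 := rpow_one_add_le_one_add_mul_self h1 hp.1 hp.2
  have h3 : t - h = t * (1 + -(h / t)) := by field_simp; ring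
  have h4 : 0 ≤ 1 + -(h / t) := by linarith
  rw [h3, Real.mul_rpow ht.le h4, Real.rpow_sub_one ht.ne']
  have htp : 0 < t ^ p := by positivity
  have h5 : t ^ p * (1 + -(h / t)) ^ p ≤ t ^ p * (1 + p * -(h / t)) := by gcongr
  have h6 : p * h * (t ^ p / t) = t ^ p * (p * (h / t)) := by field_simp
  rw [h6]
  linarith

/-- Minimum principle for a fractional differential inequality in integrated form. -/
theorem nonneg_of_rlIntegral_eq {α w₀ : ℝ} (hα : α ∈ Ioo (0 : ℝ) 1) {w q : ℝ → ℝ}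
    (hw₀ : 0 ≤ w₀) (hw : Continuous w) (hw0 : w 0 = w₀)
    (hd : ∀ t, 0 < t → DifferentiableAt ℝ w t) (hq : Continuous q)
    (heq : ∀ t, 0 < t → rlIntegral (1 - α) (fun s => w₀ - w s) t = -∫ s in Ioo 0 t, q s)
    (hneg : ∀ t, 0 < t → w t < 0 → 0 < q t) {T : ℝ} (hT : 0 ≤ T) : 0 ≤ w T := by
  -- At a negative minimum `τ`, `q > 0` nearby, so the order `1 - α` integral of `w₀ - w` does not
  -- increase up to `τ`. Splitting `w₀ - w = G - p` with `p ≥ 0` and `p τ = 0`, the constant `G`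
  -- makes it grow at rate at least of order `h` over `[τ - h, τ]`, while `p` can offset only
  -- `O(h^(2-α))`. Letting `h → 0` is contradictory.
  by_contra! hwT
  have hα1 : 0 < 1 - α := by linarith [hα.2]
  obtain ⟨τ, hτ, hmin⟩ := isCompact_Icc.exists_isMinOn (nonempty_Icc.2 hT) hw.continuousOn
  have hwτ : w τ < 0 := (hmin (right_mem_Icc.2 hT)).trans_lt hwT
  have hτ0 : 0 < τ := by
    rcases hτ.1.eq_or_lt with h | h
    · rw [← h, hw0] at hwτ; linarith
    · exact h
  set G : ℝ := w₀ - w τ with hG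
  have hGpos : 0 < G := by linarith
  set p : ℝ → ℝ := fun s => w s - w τ with hp
  have hpc : Continuous p := hw.sub continuous_const
  have hp0 : ∀ s ∈ Icc 0 τ, 0 ≤ p s := fun s hs =>
    sub_nonneg.2 (hmin ⟨hs.1, hs.2.trans hτ.2⟩)
  obtain ⟨L, hL⟩ := (hd τ hτ0).isBigO_sub.bound
  obtain ⟨δ, hδ, hball⟩ := Metric.eventually_nhds_iff.1
    (hL.and (hq.continuousAt.eventually (lt_mem_nhds (hneg τ hτ0 hwτ))))
  have hΓ := Real.Gamma_pos_of_pos hα1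
  -- the fractional integral of order `1 - α` without its constant
  set I : ℝ → ℝ := fun t => ∫ s in Ioo 0 t, (t - s) ^ (1 - α - 1) * (w₀ - w s) with hI
  set P : ℝ → ℝ := fun t => ∫ s in Ioo 0 t, (t - s) ^ (1 - α - 1) * p s with hP
  have hIval : ∀ t, 0 < t → I t = G * (t ^ (1 - α) / (1 - α)) - P t := by
    intro t ht
    have h1 := integrableOn_sub_rpow (a := 1 - α) hα1 ht
    have h2 : IntegrableOn (fun s => (t - s) ^ (1 - α - 1) * p s) (Ioo 0 t) :=
      integrableOn_sub_rpow_smul hα1 ht hpc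
    have h3 := setIntegral_sub_rpow (a := 1 - α) hα1 ht
    rw [sub_zero] at h3
    simp only [hI, hP]
    rw [← h3, ← integral_const_mul, ← integral_sub (h1.const_mul G) h2]
    refine integral_congr_ae (Eventually.of_forall fun s => ?_)
    simp only [hG, hp]; ring
  have hIq : ∀ t, 0 < t → I t = -(Real.Gamma (1 - α) * ∫ s in Ioo 0 t, q s) := by
    intro t ht
    have := heq t ht
    simp only [rlIntegral, smul_eq_mul] at this
    rw [inv_mul_eq_iff_eq_mul₀ hΓ.ne'] at this
    simp only [hI]
    rw [this]; ring
  have hkey : ∀ h ∈ Ioo 0 (min δ τ), G * τ ^ (-α) * (1 - α) ≤ L * h ^ (1 - α) := by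
    intro h hh
    have hh0 := hh.1
    have hhδ : h < δ := hh.2.trans_le (min_le_left _ _)
    have hhτ : h < τ := hh.2.trans_le (min_le_right _ _)
    have hσ : 0 < τ - h := by linarith
    have hsplit : ∀ f : ℝ → ℝ, IntegrableOn f (Ioo 0 τ) → ∫ s in Ioo 0 τ, f s =
        (∫ s in Ioo 0 (τ - h), f s) + ∫ s in Ioo (τ - h) τ, f s := by
      intro f hf
      rw [← integral_Ioc_eq_integral_Ioo, ← integral_Ioc_eq_integral_Ioo,
        ← integral_Ioc_eq_integral_Ioo, ← intervalIntegral.integral_of_le hτ0.le,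
        ← intervalIntegral.integral_of_le hσ.le, ← intervalIntegral.integral_of_le (by linarith),
        intervalIntegral.integral_add_adjacent_intervals]
      · rw [intervalIntegrable_iff_integrableOn_Ioo_of_le hσ.le]
        exact hf.mono_set (Ioo_subset_Ioo_right (by linarith))
      · rw [intervalIntegrable_iff_integrableOn_Ioo_of_le (by linarith)]
        exact hf.mono_set (Ioo_subset_Ioo_left hσ.le)
    have hnear : ∀ s ∈ Ioo (τ - h) τ, dist s τ < δ := by
      intro s hs
      rw [Real.dist_eq, abs_lt]; constructor <;> linarith [hs.1, hs.2]
    -- the fractional integral does not increase on `[τ - h, τ]`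
    have h1 : I τ ≤ I (τ - h) := by
      rw [hIq τ hτ0, hIq (τ - h) hσ, hsplit q
        ((hq.integrableOn_Icc (a := 0) (b := τ)).mono_set Ioo_subset_Icc_self)]
      have : 0 ≤ ∫ s in Ioo (τ - h) τ, q s := setIntegral_nonneg measurableSet_Ioo fun s hs =>
        (hball (hnear s hs)).2.le
      have := mul_nonneg hΓ.le this
      linarith
    -- On `(0, τ - h)` the kernel shrinks when its endpoint moves right; on the last stretch
    -- differentiability at `τ` gives `p ≤ L h`.
    have h2 : P τ ≤ P (τ - h) + L * h * (h ^ (1 - α) / (1 - α)) := by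
      have hPint : IntegrableOn (fun s => (τ - s) ^ (1 - α - 1) * p s) (Ioo 0 τ) :=
        integrableOn_sub_rpow_smul hα1 hτ0 hpc
      have hPint' : IntegrableOn (fun s => (τ - h - s) ^ (1 - α - 1) * p s) (Ioo 0 (τ - h)) :=
        integrableOn_sub_rpow_smul hα1 hσ hpc
      simp only [hP]
      rw [hsplit _ hPint]
      refine add_le_add ?_ ?_
      · refine setIntegral_mono_on (hPint.mono_set (Ioo_subset_Ioo_right (by linarith))) hPint'
          measurableSet_Ioo fun s hs => ?_
        refine mul_le_mul_of_nonneg_right ?_ (hp0 s ⟨hs.1.le, by linarith [hs.2]⟩)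
        exact Real.rpow_le_rpow_of_nonpos (by linarith [hs.2]) (by linarith) (by linarith [hα.1])
      · have h3 := setIntegral_sub_rpow (a := 1 - α) hα1 (by linarith : τ - h < τ)
        rw [sub_sub_cancel] at h3
        rw [← h3, ← integral_const_mul]
        refine setIntegral_mono_on (hPint.mono_set (Ioo_subset_Ioo_left hσ.le))
          ((integrableOn_sub_rpow hα1 (by linarith)).const_mul _) measurableSet_Ioo fun s hs => ?_
        have h4 := (hball (hnear s hs)).1
        rw [Real.norm_eq_abs, Real.norm_eq_abs, abs_sub_comm s τ,
          abs_of_nonneg (by linarith [hs.2] : 0 ≤ τ - s)] at h4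
        have hL0 : 0 ≤ L := by
          by_contra! hL0
          have h5 : L * (τ - s) < 0 := mul_neg_of_neg_of_pos hL0 (by linarith [hs.2])
          linarith [abs_nonneg (w s - w τ)]
        have h5 : p s ≤ L * h := (le_abs_self _).trans (h4.trans (by
          gcongr; linarith [hs.1]))
        have h6 : 0 ≤ (τ - s) ^ (1 - α - 1) := Real.rpow_nonneg (by linarith [hs.2]) _
        rw [mul_comm (L * h)]
        gcongr
    rw [hIval τ hτ0, hIval (τ - h) hσ] at h1
    have h3 := rpow_sub_rpow_ge (p := 1 - α) ⟨hα1.le, by linarith [hα.1]⟩ hτ0 hhτ.le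
    rw [show 1 - α - 1 = -α by ring] at h3
    have h4 : G * (τ ^ (1 - α) / (1 - α)) - G * ((τ - h) ^ (1 - α) / (1 - α)) ≤
        L * h * (h ^ (1 - α) / (1 - α)) := by linarith
    have h5 : G * ((1 - α) * h * τ ^ (-α)) ≤ L * h * h ^ (1 - α) := by
      calc G * ((1 - α) * h * τ ^ (-α)) ≤ G * (τ ^ (1 - α) - (τ - h) ^ (1 - α)) := by gcongr
        _ = (G * (τ ^ (1 - α) / (1 - α)) - G * ((τ - h) ^ (1 - α) / (1 - α))) * (1 - α) := by
          field_simp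
        _ ≤ (L * h * (h ^ (1 - α) / (1 - α))) * (1 - α) := by gcongr
        _ = _ := by field_simp
    refine le_of_mul_le_mul_left (a := h) ?_ hh0
    linarith
  have hlim : Tendsto (fun h : ℝ => L * h ^ (1 - α)) (𝓝[>] 0) (𝓝 0) := by
    have h : Tendsto (fun h : ℝ => L * h ^ (1 - α)) (𝓝 0) (𝓝 (L * 0 ^ (1 - α))) :=
      (continuous_const.mul (Real.continuous_rpow_const hα1.le)).tendsto 0
    rw [Real.zero_rpow hα1.ne', mul_zero] at h
    exact h.mono_left nhdsWithin_le_nhds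
  have hle : G * τ ^ (-α) * (1 - α) ≤ 0 := ge_of_tendsto hlim
    (by filter_upwards [Ioo_mem_nhdsGT (lt_min hδ hτ0)] with h hh using hkey h hh)
  have : 0 < G * τ ^ (-α) * (1 - α) := by positivity
  linarith

/-- The Volterra equation integrated once more, to order `1`: the form that the minimum principle
takes as input. -/
theorem rlIntegral_one_sub_mittagLeffler {α : ℝ} (hα : α ∈ Ioo (0 : ℝ) 1) (c : ℝ) {t : ℝ} :
    rlIntegral (1 - α) (fun s => 1 - mittagLeffler α (c * s ^ α)) t =
      -∫ s in Ioo 0 t, c * mittagLeffler α (c * s ^ α) := by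
  have h1 := (rlIntegral_rlIntegral_one_sub (a := 1 - α) (t := t)
    (f := fun s => mittagLeffler α (c * s ^ α))
    ⟨by linarith [hα.2], by linarith [hα.1]⟩
    ((continuous_mittagLeffler_mul_rpow hα c).integrableOn_Icc.mono_set Ioo_subset_Icc_self)).2
  rw [sub_sub_cancel] at h1
  rw [integral_const_mul, ← h1, ← neg_mul, ← rlIntegral_const_mul]
  refine rlIntegral_congr fun s hs => ?_
  rw [mittagLeffler_volterra hα c hs.1]
  ring

theorem differentiableAt_mittagLeffler_mul_rpow {α : ℝ} (hα : α ∈ Ioo (0 : ℝ) 1) (c : ℝ) {t : ℝ}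
    (ht : 0 < t) : DifferentiableAt ℝ (fun s => mittagLeffler α (c * s ^ α)) t :=
  (differentiable_mittagLeffler hα _).comp t
    ((Real.differentiableAt_rpow_const_of_ne α ht.ne').const_mul c)

/-- For `z < 0` the minimum principle applies with `q = z w`, positive wherever `w < 0`. -/
theorem mittagLeffler_nonneg {α : ℝ} (hα : α ∈ Ioo (0 : ℝ) 1) (z : ℝ) :
    0 ≤ mittagLeffler α z := by
  rcases le_or_gt 0 z with hz | hz
  · exact zero_le_one.trans (one_le_mittagLeffler hα hz)
  · have hc := continuous_mittagLeffler_mul_rpow hα z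
    have h := nonneg_of_rlIntegral_eq hα (w := fun s => mittagLeffler α (z * s ^ α))
      (q := fun s => z * mittagLeffler α (z * s ^ α)) zero_le_one hc
      (by simp [Real.zero_rpow hα.1.ne', mittagLeffler_zero])
      (fun t ht => differentiableAt_mittagLeffler_mul_rpow hα z ht) (continuous_const.mul hc)
      (fun t _ => rlIntegral_one_sub_mittagLeffler hα z)
      (fun t _ hwt => mul_pos_of_neg_of_neg hz hwt) zero_le_one
    simpa using h

/-- For `z₂ < z₁ < 0` the difference `w = w₁ - w₂` obeys the minimum principle, as `q = z₁ w + (z₁ -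
z₂) w₂` and `w₂ ≥ 0`. Nonnegative arguments are compared termwise, and opposite signs through the
value `1`. -/
theorem monotone_mittagLeffler {α : ℝ} (hα : α ∈ Ioo (0 : ℝ) 1) : Monotone (mittagLeffler α) := by
  have hle_one : ∀ z ≤ 0, mittagLeffler α z ≤ 1 := by
    intro z hz
    have h := mittagLeffler_volterra hα z one_pos
    rw [Real.one_rpow, mul_one] at h
    have : 0 ≤ rlIntegral α (fun s => mittagLeffler α (z * s ^ α)) 1 := by
      refine mul_nonneg (inv_nonneg.2 (Real.Gamma_pos_of_pos hα.1).le) ?_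
      refine setIntegral_nonneg measurableSet_Ioo fun s hs => ?_
      have : 0 ≤ 1 - s := by linarith [hs.2]
      exact mul_nonneg (by positivity) (mittagLeffler_nonneg hα _)
    have := mul_nonpos_of_nonpos_of_nonneg hz this
    linarith
  intro z₂ z₁ hz
  rcases hz.eq_or_lt with rfl | hz
  · exact le_rfl
  rcases le_or_gt 0 z₂ with h2 | h2
  · exact monotoneOn_mittagLeffler_Ici hα h2 (h2.trans hz.le) hz.le
  rcases le_or_gt 0 z₁ with h1 | h1
  · exact (hle_one z₂ h2.le).trans (one_le_mittagLeffler hα h1)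
  have hc1 := continuous_mittagLeffler_mul_rpow hα z₁
  have hc2 := continuous_mittagLeffler_mul_rpow hα z₂
  have hc3 : Continuous fun s : ℝ => 1 - mittagLeffler α (z₁ * s ^ α) := continuous_const.sub hc1
  have hc4 : Continuous fun s : ℝ => 1 - mittagLeffler α (z₂ * s ^ α) := continuous_const.sub hc2
  have hα1 : 0 < 1 - α := by linarith [hα.2]
  have h := nonneg_of_rlIntegral_eq hα
    (w := fun s => mittagLeffler α (z₁ * s ^ α) - mittagLeffler α (z₂ * s ^ α))
    (q := fun s => z₁ * mittagLeffler α (z₁ * s ^ α) - z₂ * mittagLeffler α (z₂ * s ^ α))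
    le_rfl (hc1.sub hc2) (by simp [Real.zero_rpow hα.1.ne'])
    (fun t ht => (differentiableAt_mittagLeffler_mul_rpow hα z₁ ht).sub
      (differentiableAt_mittagLeffler_mul_rpow hα z₂ ht))
    ((continuous_const.mul hc1).sub (continuous_const.mul hc2))
    (fun t ht => by
      rw [integral_sub
        ((hc1.integrableOn_Icc.mono_set Ioo_subset_Icc_self).const_mul z₁)
        ((hc2.integrableOn_Icc.mono_set Ioo_subset_Icc_self).const_mul z₂),
        neg_sub', ← rlIntegral_one_sub_mittagLeffler hα, ← rlIntegral_one_sub_mittagLeffler hα,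
        ← rlIntegral_sub (integrableOn_sub_rpow_smul hα1 ht hc3)
          (integrableOn_sub_rpow_smul hα1 ht hc4)]
      exact rlIntegral_congr fun s _ => by ring)
    (fun t _ hwt => by
      have h3 := mittagLeffler_nonneg hα (z₂ * t ^ α)
      have h4 := mul_pos_of_neg_of_neg h1 hwt
      have h5 := mul_nonneg (sub_nonneg.2 hz.le) h3
      nlinarith) zero_le_one
  simpa using h

/-- By monotonicity `E_α(-z s^α) ≥ E_α(-z)` on `(0, 1)`; inserting this in the Volterra equation at
time `1`, with `Γ(α + 1) ≤ 1`, gives `E_α(-z) ≤ 1 - z E_α(-z)`. It provides decay in frequency. -/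
theorem mittagLeffler_neg_le {α : ℝ} (hα : α ∈ Ioo (0 : ℝ) 1) {z : ℝ} (hz : 0 ≤ z) :
    mittagLeffler α (-z) ≤ 1 / (1 + z) := by
  have h0 := hα.1
  have h := mittagLeffler_volterra hα (-z) one_pos
  rw [Real.one_rpow, mul_one] at h
  have hmono : rlIntegral α (fun s => mittagLeffler α (-z) * s ^ (0 : ℝ)) 1 ≤
      rlIntegral α (fun s => mittagLeffler α (-z * s ^ α)) 1 := by
    refine rlIntegral_mono h0 
      (integrableOn_sub_rpow_smul h0 one_pos (by simpa using continuous_const))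
      (integrableOn_sub_rpow_smul h0 one_pos (continuous_mittagLeffler_mul_rpow hα _))
      fun s hs => ?_
    rw [Real.rpow_zero, mul_one]
    refine monotone_mittagLeffler hα ?_
    have : s ^ α ≤ 1 := Real.rpow_le_one hs.1.le hs.2.le h0.le
    nlinarith
  rw [rlIntegral_const_mul, rlIntegral_rpow h0 (by norm_num) one_pos] at hmono
  have hG : Real.Gamma (α + 1) ≤ 1 := by
    have := Gamma_add_le_rpow_mul one_pos hα
    simpa [add_comm] using this
  have hG0 : 0 < Real.Gamma (α + 1) := Real.Gamma_pos_of_pos (by linarith)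
  simp only [zero_add, Real.Gamma_one, add_zero, Real.one_rpow, mul_one] at hmono
  have hF := mittagLeffler_nonneg hα (-z)
  have h1 : mittagLeffler α (-z) ≤ mittagLeffler α (-z) * (1 / Real.Gamma (α + 1)) :=
    le_mul_of_one_le_right hF (by rwa [le_div_iff₀ hG0, one_mul])
  rw [le_div_iff₀ (by linarith)]
  have h2 : z * mittagLeffler α (-z) ≤ z * rlIntegral α (fun s => mittagLeffler α (-z * s ^ α)) 1 :=
    mul_le_mul_of_nonneg_left (h1.trans hmono) hz
  linarith

/-! ### The Fourier transform of the fundamental solution -/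

theorem integral_fourierInv_mul {f g : ℝ → ℂ} (hf : Integrable f) (hg : Integrable g) :
    ∫ ξ, 𝓕⁻ f ξ * g ξ = ∫ x, f x * 𝓕⁻ g x := by
  have h := VectorFourier.integral_fourierIntegral_smul_eq_flip (μ := volume) (ν := volume)
    (L := -innerₗ ℝ) Real.continuous_fourierChar
    (continuous_inner (𝕜 := ℝ) (E := ℝ)).neg hf hg
  have e : (-innerₗ ℝ : ℝ →ₗ[ℝ] ℝ →ₗ[ℝ] ℝ).flip = -innerₗ ℝ := by
    ext; simp
  rw [e] at h
  exact h

theorem norm_fourierInv_le (f : ℝ → ℂ) (ξ : ℝ) : ‖𝓕⁻ f ξ‖ ≤ ∫ x, ‖f x‖ :=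
  VectorFourier.norm_fourierIntegral_le_integral_norm _ _ _ _ _

theorem continuous_fourierInv {f : ℝ → ℂ} (hf : Integrable f) : Continuous (𝓕⁻ f) :=
  VectorFourier.fourierIntegral_continuous Real.continuous_fourierChar
    (continuous_inner (𝕜 := ℝ) (E := ℝ)).neg hf

theorem fourierInv_zero (f : ℝ → ℂ) : 𝓕⁻ f 0 = ∫ x, f x := by
  simp [Real.fourierInv_eq']

/-- A smooth bump of integral one, supported in the ball of radius `r` around `ξ`. -/
def bumpSchwartz (ξ r : ℝ) (hr : 0 < r) : 𝓢(ℝ, ℂ) :=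
  let b : ContDiffBump ξ := ⟨r / 2, r, by positivity, by linarith⟩
  HasCompactSupport.toSchwartzMap (f := fun x => ((b.normed volume x : ℝ) : ℂ))
    (b.hasCompactSupport_normed.comp_left Complex.ofReal_zero)
    (Complex.ofRealCLM.contDiff.comp b.contDiff_normed)

theorem hasCompactSupport_bumpSchwartz (ξ r : ℝ) (hr : 0 < r) :
    HasCompactSupport (bumpSchwartz ξ r hr) :=
  (ContDiffBump.hasCompactSupport_normed _).comp_left Complex.ofReal_zero

theorem integral_bumpSchwartz (ξ r : ℝ) (hr : 0 < r) : ∫ x, bumpSchwartz ξ r hr x = 1 := by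
  set b : ContDiffBump ξ := ⟨r / 2, r, by positivity, by linarith⟩ with hb
  change ∫ x, ((b.normed volume x : ℝ) : ℂ) = 1
  rw [integral_complex_ofReal, b.integral_normed, Complex.ofReal_one]

theorem norm_integral_mul_bumpSchwartz_sub_le {ξ r B : ℝ} (hr : 0 < r) {h : ℝ → ℂ} {c : ℂ}
    (hh : Continuous h) (hB : ∀ x, |x - ξ| ≤ r → ‖h x - c‖ ≤ B) :
    ‖(∫ x, h x * bumpSchwartz ξ r hr x) - c‖ ≤ B := by
  have hint : Integrable (fun x => h x * bumpSchwartz ξ r hr x) :=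
    (hh.mul (bumpSchwartz ξ r hr).continuous).integrable_of_hasCompactSupport
      (hasCompactSupport_bumpSchwartz ξ r hr).mul_left
  have e : (∫ x, h x * bumpSchwartz ξ r hr x) - c =
      ∫ x, (h x - c) * bumpSchwartz ξ r hr x := by
    simp only [sub_mul]
    rw [integral_sub hint ((bumpSchwartz ξ r hr).integrable.const_mul c), integral_const_mul,
      integral_bumpSchwartz, mul_one]
  rw [e]
  set b : ContDiffBump ξ := ⟨r / 2, r, by positivity, by linarith⟩ with hb
  have hval : ∀ x, bumpSchwartz ξ r hr x = ((b.normed volume x : ℝ) : ℂ) := fun _ => rfl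
  calc _ ≤ ∫ x, B * b.normed volume x := by
        refine norm_integral_le_of_norm_le (b.integrable_normed.const_mul B)
          (Eventually.of_forall fun x => ?_)
        rw [hval, norm_mul, Complex.norm_real, Real.norm_of_nonneg (b.nonneg_normed x)]
        by_cases hx : |x - ξ| ≤ r
        · exact mul_le_mul_of_nonneg_right (hB x hx) (b.nonneg_normed x)
        · have : b.normed volume x = 0 := by
            rw [← Function.notMem_support, b.support_normed_eq, Metric.mem_ball, Real.dist_eq]
            exact fun h => hx h.le
          simp [this]
    _ = B := by rw [integral_const_mul, b.integral_normed, mul_one]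

theorem tendsto_integral_mul_bumpSchwartz {h : ℝ → ℂ} (hh : Continuous h) (ξ : ℝ) :
    Tendsto (fun n : ℕ => ∫ x, h x * bumpSchwartz ξ (1 / ((n : ℝ) + 1)) (by positivity) x)
      atTop (𝓝 (h ξ)) := by
  rw [Metric.tendsto_atTop]
  intro ε hε
  obtain ⟨δ, hδ, hball⟩ := Metric.continuous_iff.1 hh ξ (ε / 2) (by positivity)
  obtain ⟨N, hN⟩ := exists_nat_one_div_lt hδ
  refine ⟨N, fun n hn => ?_⟩
  rw [dist_eq_norm]
  refine (norm_integral_mul_bumpSchwartz_sub_le _ hh (B := ε / 2) fun x hx => ?_).trans_lt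
    (by linarith)
  rw [← dist_eq_norm]
  refine (hball x ?_).le
  rw [Real.dist_eq]
  calc |x - ξ| ≤ 1 / ((n : ℝ) + 1) := hx
    _ ≤ 1 / ((N : ℝ) + 1) := by gcongr
    _ < δ := hN

/-- The symbol of `(-Δ)^ϱ` in the frequency variable of Mathlib's Fourier transform. -/
def fracSymbol (ϱ ξ : ℝ) : ℝ := (2 * Real.pi * |ξ|) ^ (2 * ϱ)

theorem continuous_fracSymbol {ϱ : ℝ} (hϱ : 0 ≤ ϱ) : Continuous (fracSymbol ϱ) :=
  (Real.continuous_rpow_const (by positivity)).comp (by fun_prop)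

namespace IsFundamentalSolution

variable {α ϱ : ℝ} {u : ℝ → ℝ → ℝ}

theorem integrable_ofReal (hu : IsFundamentalSolution α ϱ u) {t : ℝ} (ht : 0 < t) :
    Integrable (fun x => (u t x : ℂ)) := (hu.integrable t ht).ofReal

/-- The integrated equation, on the Fourier side and tested against `ψ`. -/
theorem fourier_pairing (hu : IsFundamentalSolution α ϱ u) (hα : α ∈ Ioo (0 : ℝ) 1)
    (hϱ : 0 ≤ ϱ) (ψ : 𝓢(ℝ, ℂ)) (hψ : HasCompactSupport ψ) {t : ℝ} (ht : 0 < t) :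
    AEStronglyMeasurable (fun s => ∫ ξ, 𝓕⁻ (fun x => (u s x : ℂ)) ξ * ψ ξ)
        (volume.restrict (Ioo 0 t)) ∧
      IntegrableOn (fun s => (t - s) ^ (α - 1) •
        ∫ ξ, 𝓕⁻ (fun x => (u s x : ℂ)) ξ * ((1 - fracSymbol ϱ ξ : ℝ) : ℂ) * ψ ξ) (Ioo 0 t) ∧
      (∫ ξ, 𝓕⁻ (fun x => (u t x : ℂ)) ξ * ψ ξ) = (∫ ξ, ψ ξ) + rlIntegral α
        (fun s => ∫ ξ, 𝓕⁻ (fun x => (u s x : ℂ)) ξ * ((1 - fracSymbol ϱ ξ : ℝ) : ℂ) * ψ ξ) t := by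
  have hα1 : 0 < 1 - α := by linarith [hα.2]
  -- With this choice `fracLaplacian ϱ φ` is the inverse transform of `σψ`; the compact support of
  -- `ψ` makes `σψ` integrable.
  set φ : 𝓢(ℝ, ℂ) := 𝓕⁻ ψ with hφ
  have hφc : (φ : ℝ → ℂ) = 𝓕⁻ (ψ : ℝ → ℂ) := SchwartzMap.fourierInv_coe ψ
  have hφψ : 𝓕 (φ : ℝ → ℂ) = ψ := by
    rw [← SchwartzMap.fourier_coe, hφ, FourierTransform.fourier_fourierInv_eq]
  set f : ℝ → ℂ := fun s => ∫ x, (u s x : ℂ) * φ x with hf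
  have hfU : ∀ s, 0 < s → f s = ∫ ξ, 𝓕⁻ (fun x => (u s x : ℂ)) ξ * ψ ξ := by
    intro s hs
    rw [integral_fourierInv_mul (hu.integrable_ofReal hs) ψ.integrable]
    simp only [hf, hφc]
  set D : ℝ → ℂ := fun s =>
    ∫ ξ, 𝓕⁻ (fun x => (u s x : ℂ)) ξ * ((1 - fracSymbol ϱ ξ : ℝ) : ℂ) * ψ ξ with hD
  have hσ : Continuous fun ξ => ((fracSymbol ϱ ξ : ℝ) : ℂ) :=
    Complex.continuous_ofReal.comp (continuous_fracSymbol hϱ)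
  have hσψ : Integrable fun ξ => ((fracSymbol ϱ ξ : ℝ) : ℂ) * ψ ξ :=
    (hσ.mul ψ.continuous).integrable_of_hasCompactSupport hψ.mul_left
  have hDval : ∀ s, 0 < s →
      (∫ x, (u s x : ℂ) * φ x) - ∫ x, (u s x : ℂ) * fracLaplacian ϱ φ x = D s := by
    intro s hs
    have hUc := continuous_fourierInv (hu.integrable_ofReal hs)
    have e1 : ∫ x, (u s x : ℂ) * fracLaplacian ϱ φ x =
        ∫ ξ, 𝓕⁻ (fun x => (u s x : ℂ)) ξ * (((fracSymbol ϱ ξ : ℝ) : ℂ) * ψ ξ) := by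
      rw [integral_fourierInv_mul (hu.integrable_ofReal hs) hσψ]
      simp only [fracLaplacian, hφψ, fracSymbol]
    have h1 : Integrable fun ξ => 𝓕⁻ (fun x => (u s x : ℂ)) ξ * ψ ξ :=
      (hUc.mul ψ.continuous).integrable_of_hasCompactSupport hψ.mul_left
    have h2 : Integrable fun ξ =>
        𝓕⁻ (fun x => (u s x : ℂ)) ξ * (((fracSymbol ϱ ξ : ℝ) : ℂ) * ψ ξ) :=
      (hUc.mul (hσ.mul ψ.continuous)).integrable_of_hasCompactSupport hψ.mul_left.mul_left
    rw [e1, show (∫ x, (u s x : ℂ) * φ x) = _ from hfU s hs, ← integral_sub h1 h2]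
    refine integral_congr_ae (Eventually.of_forall fun ξ => ?_)
    push_cast
    ring
  have hcap : ∀ s, 0 < s → HasCaputoDerivAt α f (D s) s := fun s hs => by
    rw [← hDval s hs]; exact hu.equation φ s hs
  -- The equation at time `s` gives differentiability only before `s`, so it is used at time `s +
  -- 1`.
  have hder : ∀ s, 0 < s → DifferentiableAt ℝ f s := fun s hs =>
    ((hcap (s + 1) (by linarith)).differentiableOn s ⟨hs, by linarith⟩).differentiableAt
      (Ioo_mem_nhds hs (by linarith))
  have hf'int : IntegrableOn (deriv f) (Ioo 0 t) := by
    have h1 := (hcap t ht).integrable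
    have h2 : IntegrableOn (fun s => (t - s) ^ α • ((t - s) ^ (-α) • deriv f s)) (Ioo 0 t) := by
      have hm : AEStronglyMeasurable (fun s : ℝ => (t - s) ^ α) (volume.restrict (Ioo 0 t)) :=
        ((Real.continuous_rpow_const hα.1.le).comp
          (continuous_const.sub continuous_id)).aestronglyMeasurable
      refine Integrable.bdd_smul (φ := fun s : ℝ => (t - s) ^ α) h1 (t ^ α) hm ?_
      filter_upwards [ae_restrict_mem measurableSet_Ioo] with s hs
      have h3 : 0 ≤ t - s := by linarith [hs.2]
      rw [Real.norm_of_nonneg (by positivity)]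
      exact Real.rpow_le_rpow h3 (by linarith [hs.1]) hα.1.le
    refine h2.congr_fun (fun s hs => ?_) measurableSet_Ioo
    have h3 : 0 < t - s := by linarith [hs.2]
    simp only [smul_smul]
    rw [← Real.rpow_add h3]
    simp
  have hrl : ∀ s ∈ Ioo 0 t, rlIntegral (1 - α) (deriv f) s = D s := by
    intro s hs
    rw [← (hcap s hs.1).eq, rlIntegral, show 1 - α - 1 = -α by ring]
  have hFTC : ∫ s in Ioo 0 t, deriv f s = f t - φ 0 := by
    rw [← integral_Ioc_eq_integral_Ioo, ← intervalIntegral.integral_of_le ht.le]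
    refine intervalIntegral.integral_eq_sub_of_hasDerivAt_of_tendsto ht
      (fun s hs => (hder s hs.1).hasDerivAt) ?_ (hu.initial φ)
      ((hder t ht).continuousAt.tendsto.mono_left nhdsWithin_le_nhds)
    rwa [intervalIntegrable_iff_integrableOn_Ioo_of_le ht.le]
  obtain ⟨hI, hsemi⟩ := rlIntegral_rlIntegral_one_sub hα hf'int
  refine ⟨?_, ?_, ?_⟩
  · have : ContinuousOn f (Ioo 0 t) := fun s hs =>
      (hder s hs.1).continuousAt.continuousWithinAt
    refine (this.aestronglyMeasurable measurableSet_Ioo).congr ?_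
    filter_upwards [ae_restrict_mem measurableSet_Ioo] with s hs using hfU s hs.1
  · exact hI.congr_fun (fun s hs => by simp only [hrl s hs, hD]) measurableSet_Ioo
  · rw [← hfU t ht, ← rlIntegral_congr hrl, hsemi, hFTC, hφc, fourierInv_zero]
    ring

/-- The Fourier transform solves, at each frequency, a scalar Volterra equation. -/
theorem fourierInv_volterra (hu : IsFundamentalSolution α ϱ u) (hα : α ∈ Ioo (0 : ℝ) 1)
    (hϱ : 0 ≤ ϱ) (ξ : ℝ) {t : ℝ} (ht : 0 < t) :
    IntegrableOn (fun s => (t - s) ^ (α - 1) • 𝓕⁻ (fun x => (u s x : ℂ)) ξ) (Ioo 0 t) ∧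
      𝓕⁻ (fun x => (u t x : ℂ)) ξ = 1 +
        (1 - fracSymbol ϱ ξ) • rlIntegral α (fun s => 𝓕⁻ (fun x => (u s x : ℂ)) ξ) t := by
  obtain ⟨M, hM⟩ := hu.bounded t ht
  have hU : ∀ s ∈ Ioc 0 t, ∀ η, ‖𝓕⁻ (fun x => (u s x : ℂ)) η‖ ≤ M := by
    intro s hs η
    refine (norm_fourierInv_le _ η).trans ?_
    simpa using hM s hs
  have hUc : ∀ s, 0 < s → Continuous (𝓕⁻ (fun x => (u s x : ℂ))) := fun s hs =>
    continuous_fourierInv (hu.integrable_ofReal hs)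
  have hM0 : 0 ≤ M := (norm_nonneg _).trans (hU t ⟨ht, le_rfl⟩ 0)
  have hlam : Continuous fun η => ((1 - fracSymbol ϱ η : ℝ) : ℂ) :=
    Complex.continuous_ofReal.comp (continuous_const.sub (continuous_fracSymbol hϱ))
  have hUlam : ∀ s, 0 < s → Continuous fun η =>
      𝓕⁻ (fun x => (u s x : ℂ)) η * ((1 - fracSymbol ϱ η : ℝ) : ℂ) := fun s hs =>
    (hUc s hs).mul hlam
  set ψ : ℕ → 𝓢(ℝ, ℂ) := fun n => bumpSchwartz ξ (1 / ((n : ℝ) + 1)) (by positivity) with hψ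
  have hp := fun n => hu.fourier_pairing hα hϱ (ψ n) (hasCompactSupport_bumpSchwartz _ _ _) ht
  have hmeas : AEStronglyMeasurable (fun s => 𝓕⁻ (fun x => (u s x : ℂ)) ξ)
      (volume.restrict (Ioo 0 t)) := by
    refine aestronglyMeasurable_of_tendsto_ae atTop (fun n => (hp n).1) ?_
    filter_upwards [ae_restrict_mem measurableSet_Ioo] with s hs
    exact tendsto_integral_mul_bumpSchwartz (hUc s hs.1) ξ
  have hker := integrableOn_sub_rpow hα.1 ht
  refine ⟨?_, ?_⟩
  · refine Integrable.smul_bdd hker M hmeas ?_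
    filter_upwards [ae_restrict_mem measurableSet_Ioo] with s hs
    exact hU s ⟨hs.1, hs.2.le⟩ ξ
  · obtain ⟨B, hB⟩ := (isCompact_closedBall ξ 1).exists_bound_of_continuousOn hlam.continuousOn
    -- The bumps have radius at most `1`, so `M * B`, with `B` bounding `1 - σ` on the unit ball
    -- around `ξ`, dominates uniformly in `n`.
    have hlim : Tendsto (fun n => ∫ s in Ioo 0 t, (t - s) ^ (α - 1) •
        ∫ η, 𝓕⁻ (fun x => (u s x : ℂ)) η * ((1 - fracSymbol ϱ η : ℝ) : ℂ) * ψ n η) atTop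
        (𝓝 (∫ s in Ioo 0 t, (t - s) ^ (α - 1) •
          (𝓕⁻ (fun x => (u s x : ℂ)) ξ * ((1 - fracSymbol ϱ ξ : ℝ) : ℂ)))) := by
      refine tendsto_integral_of_dominated_convergence (fun s => (t - s) ^ (α - 1) * (M * B))
        (fun n => (hp n).2.1.aestronglyMeasurable) (hker.mul_const _) (fun n => ?_) ?_
      · filter_upwards [ae_restrict_mem measurableSet_Ioo] with s hs
        have h1 : 0 ≤ t - s := by linarith [hs.2]
        rw [norm_smul, Real.norm_of_nonneg (by positivity)]
        gcongr
        have h2 := norm_integral_mul_bumpSchwartz_sub_le (ξ := ξ) (r := 1 / ((n : ℝ) + 1))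
          (B := M * B) (c := 0) (by positivity) (hUlam s hs.1) (fun x hx => ?_)
        · rwa [sub_zero] at h2
        · rw [sub_zero, norm_mul]
          refine mul_le_mul (hU s ⟨hs.1, hs.2.le⟩ x) (hB x ?_) (norm_nonneg _) hM0
          rw [Metric.mem_closedBall, Real.dist_eq]
          refine hx.trans ?_
          rw [div_le_one (by positivity)]
          have : (0 : ℝ) ≤ n := n.cast_nonneg
          linarith
      · filter_upwards [ae_restrict_mem measurableSet_Ioo] with s hs
        exact (tendsto_integral_mul_bumpSchwartz (hUlam s hs.1) ξ).const_smul _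
    have hlim2 := (hlim.const_smul (Real.Gamma α)⁻¹).const_add 1
    have hlim3 := tendsto_integral_mul_bumpSchwartz (hUc t ht) ξ
    refine tendsto_nhds_unique hlim3 ?_
    have e1 : (1 - fracSymbol ϱ ξ) • rlIntegral α (fun s => 𝓕⁻ (fun x => (u s x : ℂ)) ξ) t =
        (Real.Gamma α)⁻¹ • ∫ s in Ioo 0 t, (t - s) ^ (α - 1) •
          (𝓕⁻ (fun x => (u s x : ℂ)) ξ * ((1 - fracSymbol ϱ ξ : ℝ) : ℂ)) := by
      rw [rlIntegral, smul_comm]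
      congr 1
      rw [← integral_smul]
      refine integral_congr_ae (Eventually.of_forall fun s => ?_)
      simp only [Complex.real_smul]
      ring
    rw [e1]
    refine hlim2.congr fun n => ?_
    have h := (hp n).2.2
    rw [integral_bumpSchwartz] at h
    exact h.symm

theorem fourierInv_eq (hu : IsFundamentalSolution α ϱ u) (hα : α ∈ Ioo (0 : ℝ) 1)
    (hϱ : 0 ≤ ϱ) {t : ℝ} (ht : 0 < t) (ξ : ℝ) :
    𝓕⁻ (fun x => (u t x : ℂ)) ξ = (mittagLeffler α ((1 - fracSymbol ϱ ξ) * t ^ α) : ℂ) := by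
  obtain ⟨M, hM⟩ := hu.bounded t ht
  refine eq_mittagLeffler_of_volterra hα (M := M) (T := t)
    (y := fun s => 𝓕⁻ (fun x => (u s x : ℂ)) ξ)
    (fun s hs => (hu.fourierInv_volterra hα hϱ ξ hs.1).1)
    (fun s hs => (hu.fourierInv_volterra hα hϱ ξ hs.1).2) (fun s hs => ?_) ⟨ht, le_rfl⟩
  refine (norm_fourierInv_le _ ξ).trans ?_
  simpa using hM s hs

end IsFundamentalSolution

/-! ### Lower bounds for the fundamental solution -/

theorem fracSymbol_le_fracSymbol {ϱ ξ η : ℝ} (hϱ : 0 ≤ ϱ) (h : |ξ| ≤ |η|) :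
    fracSymbol ϱ ξ ≤ fracSymbol ϱ η := by
  have := Real.pi_pos
  unfold fracSymbol
  gcongr

theorem mittagLeffler_symbol_anti {α ϱ t ξ η : ℝ} (hα : α ∈ Ioo (0 : ℝ) 1) (hϱ : 0 ≤ ϱ)
    (ht : 0 ≤ t) (h : |ξ| ≤ |η|) :
    mittagLeffler α ((1 - fracSymbol ϱ η) * t ^ α) ≤
      mittagLeffler α ((1 - fracSymbol ϱ ξ) * t ^ α) := by
  refine monotone_mittagLeffler hα ?_
  have := fracSymbol_le_fracSymbol hϱ h
  gcongr

/-- An integrable majorant beyond `ξ₀` whose profile does not depend on `t`. For `η ≤ 1` the profile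
is at least `1` and monotonicity suffices; for `η ≥ 1`, `t ≥ 1` and `ϱ ≥ 1` give at most `E_α(-(η² -
1)) ≤ η⁻²`. -/
theorem mittagLeffler_symbol_le {α ϱ t ξ₀ ξ : ℝ} (hα : α ∈ Ioo (0 : ℝ) 1) (hϱ : 1 ≤ ϱ)
    (ht : 1 ≤ t) (h : |ξ₀| ≤ |ξ|) :
    mittagLeffler α ((1 - fracSymbol ϱ ξ) * t ^ α) ≤
      (mittagLeffler α ((1 - fracSymbol ϱ ξ₀) * t ^ α) + 1) *
        (2 * (1 + (2 * Real.pi * ξ) ^ 2)⁻¹) := by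
  set η : ℝ := 2 * Real.pi * |ξ| with hη
  have hη0 : 0 ≤ η := by have := Real.pi_pos; positivity
  have hη2 : (2 * Real.pi * ξ) ^ 2 = η ^ 2 := by rw [hη, mul_pow, mul_pow _ |ξ|, sq_abs]
  have hG0 := mittagLeffler_nonneg hα ((1 - fracSymbol ϱ ξ₀) * t ^ α)
  rw [hη2, ← div_eq_mul_inv]
  rcases le_total η 1 with h1 | h1
  · have h2 : 1 ≤ 2 / (1 + η ^ 2) := by
      rw [le_div_iff₀ (by positivity)]; nlinarith
    calc _ ≤ mittagLeffler α ((1 - fracSymbol ϱ ξ₀) * t ^ α) :=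
          mittagLeffler_symbol_anti hα (by linarith) (by linarith) h
      _ ≤ (mittagLeffler α ((1 - fracSymbol ϱ ξ₀) * t ^ α) + 1) * 1 := by linarith
      _ ≤ _ := by gcongr
  · have hσ : η ^ 2 ≤ fracSymbol ϱ ξ := by
      rw [fracSymbol, ← hη, ← Real.rpow_natCast]
      exact Real.rpow_le_rpow_of_exponent_le h1 (by push_cast; linarith)
    have hη1 : 1 ≤ η ^ 2 := one_le_pow₀ h1
    have htα : 1 ≤ t ^ α := Real.one_le_rpow ht hα.1.le
    have h2 : (1 - fracSymbol ϱ ξ) * t ^ α ≤ -(η ^ 2 - 1) := by nlinarith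
    calc _ ≤ mittagLeffler α (-(η ^ 2 - 1)) := monotone_mittagLeffler hα h2
      _ ≤ 1 / (1 + (η ^ 2 - 1)) := mittagLeffler_neg_le hα (by linarith)
      _ ≤ 2 / (1 + η ^ 2) := by
        rw [div_le_div_iff₀ (by linarith) (by positivity)]; linarith
      _ ≤ _ := le_mul_of_one_le_left (by positivity) (by linarith)

theorem integrable_two_mul_inv_one_add_sq :
    Integrable fun ξ : ℝ => 2 * (1 + (2 * Real.pi * ξ) ^ 2)⁻¹ :=
  (integrable_inv_one_add_sq.comp_mul_left' (by positivity)).const_mul 2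

theorem integrable_mittagLeffler_symbol {α ϱ t : ℝ} (hα : α ∈ Ioo (0 : ℝ) 1) (hϱ : 1 ≤ ϱ)
    (ht : 1 ≤ t) : Integrable fun ξ => mittagLeffler α ((1 - fracSymbol ϱ ξ) * t ^ α) := by
  refine (integrable_two_mul_inv_one_add_sq.const_mul
    (mittagLeffler α ((1 - fracSymbol ϱ 0) * t ^ α) + 1)).mono' ?_
    (Eventually.of_forall fun ξ => ?_)
  · exact ((differentiable_mittagLeffler hα).continuous.comp ((continuous_const.sub
      (continuous_fracSymbol (by linarith))).mul continuous_const)).aestronglyMeasurable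
  · rw [Real.norm_of_nonneg (mittagLeffler_nonneg hα _)]
    exact mittagLeffler_symbol_le hα hϱ ht (by simp)

namespace IsFundamentalSolution

variable {α ϱ : ℝ} {u : ℝ → ℝ → ℝ}

theorem eq_integral_cos (hu : IsFundamentalSolution α ϱ u) (hα : α ∈ Ioo (0 : ℝ) 1)
    (hϱ : 1 ≤ ϱ) {t : ℝ} (ht : 1 ≤ t) (x : ℝ) :
    u t x = ∫ ξ, Real.cos (2 * Real.pi * ξ * x) *
      mittagLeffler α ((1 - fracSymbol ϱ ξ) * t ^ α) := by
  have ht0 : 0 < t := by linarith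
  have hG := integrable_mittagLeffler_symbol hα hϱ ht
  have hU : 𝓕⁻ (fun x => (u t x : ℂ)) =
      fun ξ => ((mittagLeffler α ((1 - fracSymbol ϱ ξ) * t ^ α) : ℝ) : ℂ) :=
    funext fun ξ => hu.fourierInv_eq hα (by linarith) ht0 ξ
  have hFint : Integrable (𝓕 (fun x => (u t x : ℂ))) := by
    have h : 𝓕 (fun x => (u t x : ℂ)) = fun ξ => 𝓕⁻ (fun x => (u t x : ℂ)) (-ξ) := by
      ext ξ
      rw [Real.fourierInv_eq_fourier_neg, neg_neg]
    rw [h, hU]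
    exact hG.comp_neg.ofReal
  have hinv : 𝓕 (𝓕⁻ (fun x => (u t x : ℂ))) x = (u t x : ℂ) :=
    (hu.integrable_ofReal ht0).fourier_fourierInv_eq hFint
      (Complex.continuous_ofReal.comp (hu.continuous t ht0)).continuousAt
  rw [hU, Real.fourier_real_eq_integral_exp_smul] at hinv
  have hint : Integrable fun ξ : ℝ => Complex.exp (↑(-2 * Real.pi * ξ * x) * Complex.I) •
      ((mittagLeffler α ((1 - fracSymbol ϱ ξ) * t ^ α) : ℝ) : ℂ) := by
    refine Integrable.bdd_mul (c := 1) hG.ofReal ?_ (Eventually.of_forall fun ξ => ?_)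
    · exact Continuous.aestronglyMeasurable (by fun_prop)
    · rw [Complex.norm_exp_ofReal_mul_I]
  have hre := congrArg Complex.re hinv
  rw [Complex.ofReal_re] at hre
  rw [← hre, ← Complex.reCLM_apply, ← Complex.reCLM.integral_comp_comm hint]
  refine integral_congr_ae (Eventually.of_forall fun ξ => ?_)
  simp only [Complex.reCLM_apply, smul_eq_mul]
  rw [Complex.re_mul_ofReal, Complex.exp_ofReal_mul_I_re, ← Real.cos_neg]
  congr 2
  ring

/-- On `[-δ, δ]` the integrand is at least half the transform at `δ`; the rest of the lobe `|ξ| ≤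
1/(2π|x|)` is nonnegative and dropped; beyond it `cos ≥ -1` and the majorant are used. -/
theorem lower_bound (hu : IsFundamentalSolution α ϱ u) (hα : α ∈ Ioo (0 : ℝ) 1)
    (hϱ : 1 ≤ ϱ) {t x δ : ℝ} (ht : 1 ≤ t) (hδ : 0 < δ) (hx : 0 < |x|)
    (hδx : δ ≤ 1 / (2 * Real.pi * |x|)) :
    δ * mittagLeffler α ((1 - fracSymbol ϱ δ) * t ^ α) -
        (mittagLeffler α ((1 - fracSymbol ϱ (1 / (2 * Real.pi * |x|))) * t ^ α) + 1) *
          (∫ ξ : ℝ, 2 * (1 + (2 * Real.pi * ξ) ^ 2)⁻¹) ≤ u t x := by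
  have hpi := Real.pi_pos
  set G : ℝ → ℝ := fun ξ => mittagLeffler α ((1 - fracSymbol ϱ ξ) * t ^ α) with hG
  set ξ₀ : ℝ := 1 / (2 * Real.pi * |x|) with hξ₀
  have hξ₀pos : 0 < ξ₀ := by positivity
  have hGnn : ∀ ξ, 0 ≤ G ξ := fun ξ => mittagLeffler_nonneg hα _
  have hGint : Integrable G := integrable_mittagLeffler_symbol hα hϱ ht
  have hcos : ∀ ξ, |ξ| ≤ ξ₀ → 1 / 2 ≤ Real.cos (2 * Real.pi * ξ * x) := by
    intro ξ hξ
    have h1 : |2 * Real.pi * ξ * x| ≤ 1 := by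
      rw [abs_mul, abs_mul, abs_of_pos (by positivity : 0 < 2 * Real.pi)]
      calc 2 * Real.pi * |ξ| * |x| ≤ 2 * Real.pi * ξ₀ * |x| := by gcongr
        _ = 1 := by rw [hξ₀]; field_simp
    have h2 := Real.one_sub_sq_div_two_le_cos (x := 2 * Real.pi * ξ * x)
    have h3 : (2 * Real.pi * ξ * x) ^ 2 ≤ 1 := by
      rw [← sq_abs]; exact pow_le_one₀ (abs_nonneg _) h1
    linarith
  have hpoint : ∀ ξ, (Icc (-δ) δ).indicator (fun _ => 1 / 2 * G δ) ξ -
      (G ξ₀ + 1) * (2 * (1 + (2 * Real.pi * ξ) ^ 2)⁻¹) ≤ Real.cos (2 * Real.pi * ξ * x) * G ξ := by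
    intro ξ
    have hB : 0 ≤ (G ξ₀ + 1) * (2 * (1 + (2 * Real.pi * ξ) ^ 2)⁻¹) := by
      have := hGnn ξ₀
      positivity
    by_cases h1 : ξ ∈ Icc (-δ) δ
    · rw [indicator_of_mem h1]
      have h2 : |ξ| ≤ δ := abs_le.2 h1
      have h3 : G δ ≤ G ξ := mittagLeffler_symbol_anti hα (by linarith) (by linarith)
        (by rwa [abs_of_pos hδ])
      have h4 : 1 / 2 * G δ ≤ Real.cos (2 * Real.pi * ξ * x) * G ξ :=
        mul_le_mul (hcos ξ (h2.trans hδx)) h3 (hGnn _)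
          (le_trans (by norm_num) (hcos ξ (h2.trans hδx)))
      linarith
    · rw [indicator_of_notMem h1, zero_sub]
      rcases le_total |ξ| ξ₀ with h2 | h2
      · have := mul_nonneg (le_trans (by norm_num) (hcos ξ h2)) (hGnn ξ)
        linarith
      · have h3 : G ξ ≤ _ := mittagLeffler_symbol_le hα hϱ ht (ξ₀ := ξ₀)
          (by rwa [abs_of_pos hξ₀pos])
        have h4 : -1 * G ξ ≤ Real.cos (2 * Real.pi * ξ * x) * G ξ :=
          mul_le_mul_of_nonneg_right (Real.neg_one_le_cos _) (hGnn ξ)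
        linarith
  rw [hu.eq_integral_cos hα hϱ ht x]
  have hind : Integrable ((Icc (-δ) δ).indicator (fun _ : ℝ => 1 / 2 * G δ)) :=
    (integrable_indicator_iff measurableSet_Icc).2 continuous_const.integrableOn_Icc
  have hcosint : Integrable fun ξ => Real.cos (2 * Real.pi * ξ * x) * G ξ := by
    refine Integrable.bdd_mul (c := 1) hGint ?_ (Eventually.of_forall fun ξ => ?_)
    · exact Continuous.aestronglyMeasurable (by fun_prop)
    · exact Real.abs_cos_le_one _
  have h := integral_mono (hind.sub (integrable_two_mul_inv_one_add_sq.const_mul (G ξ₀ + 1)))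
    hcosint hpoint
  simp only [Pi.sub_apply] at h
  rw [integral_sub hind (integrable_two_mul_inv_one_add_sq.const_mul (G ξ₀ + 1)),
    integral_const_mul, integral_indicator measurableSet_Icc, setIntegral_const,
    Real.volume_real_Icc_of_le (by linarith), smul_eq_mul] at h
  calc _ = (δ - -δ) * (1 / 2 * G δ) - (G ξ₀ + 1) *
        (∫ ξ : ℝ, 2 * (1 + (2 * Real.pi * ξ) ^ 2)⁻¹) := by simp only [hG]; ring
    _ ≤ _ := h

end IsFundamentalSolution

/-! ### Growth along the curve `|x| = m t^β` -/

theorem tendsto_rpow_neg_mul_mittagLeffler {α : ℝ} (hα : α ∈ Ioo (0 : ℝ) 1) (s : ℝ) :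
    Tendsto (fun t : ℝ => t ^ (-s) * mittagLeffler α (t ^ α)) atTop atTop := by
  obtain ⟨r, hr⟩ := exists_nat_gt (s / α)
  have hr' : 0 < α * r - s := by
    rw [div_lt_iff₀ hα.1] at hr; linarith
  have hG := Gamma_mul_nat_add_one_pos hα.1 r
  have hlim : Tendsto (fun t : ℝ => t ^ (α * r - s) / Real.Gamma (α * r + 1)) atTop atTop :=
    (tendsto_rpow_atTop hr').atTop_div_const hG
  refine tendsto_atTop_mono' _ ?_ hlim
  filter_upwards [eventually_gt_atTop 0] with t ht
  have h := pow_div_Gamma_le_mittagLeffler hα (Real.rpow_nonneg ht.le α) r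
  rw [← Real.rpow_natCast, ← Real.rpow_mul ht.le] at h
  calc t ^ (α * r - s) / Real.Gamma (α * r + 1)
      = t ^ (-s) * (t ^ (α * r) / Real.Gamma (α * r + 1)) := by
        rw [sub_eq_add_neg, Real.rpow_add ht]; ring
    _ ≤ _ := by gcongr

/-- Along `|x| = m t^β` with `β` subcritical, the solution is at least of order
`t^(-1/(2ϱ)) E_α(t^α)`. -/
theorem IsFundamentalSolution.exists_eventually_le {α ϱ β m : ℝ} {u : ℝ → ℝ → ℝ}
    (hu : IsFundamentalSolution α ϱ u) (hα : α ∈ Ioo (0 : ℝ) 1) (hϱ : 1 ≤ ϱ)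
    (hβ : β ∈ Ioo (0 : ℝ) (1 / (2 * ϱ))) (hm : 0 < m) :
    ∃ c : ℝ, 0 < c ∧ ∀ᶠ t in atTop, ∀ v : ℝ, |v| = 1 →
      c * (t ^ (-(1 / (2 * ϱ))) * mittagLeffler α (t ^ α)) ≤ u t (m * t ^ β * v) := by
  have hpi := Real.pi_pos
  have hϱ0 : 0 < ϱ := by linarith
  set s : ℝ := 1 / (2 * ϱ) with hs
  have hs0 : 0 < s := by positivity
  have hsϱ : s * (2 * ϱ) = 1 := by rw [hs]; field_simp
  set K : ℝ := ∫ ξ : ℝ, 2 * (1 + (2 * Real.pi * ξ) ^ 2)⁻¹ with hK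
  have hK0 : 0 ≤ K := integral_nonneg fun ξ => by positivity
  obtain ⟨c, hc, hclow⟩ := exists_mul_mittagLeffler_le hα
  set b : ℝ := 1 - β * (2 * ϱ) with hb
  have hb0 : 0 < b := by
    have := mul_lt_mul_of_pos_right hβ.2 (by positivity : 0 < 2 * ϱ)
    rw [hsϱ] at this
    linarith
  -- Below, `t * y` is a constant times `t^b`, so the outer frequencies carry `t^(-bαq)`; this `q`
  -- makes it beat the factor `t^(-s)` of the main term.
  obtain ⟨q, hq⟩ := exists_nat_gt (s / (b * α))
  have hα0 := hα.1
  rw [div_lt_iff₀ (by positivity)] at hq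
  obtain ⟨C, hC, hCup⟩ := exists_mittagLeffler_le hα q
  set c₀ : ℝ := c / (2 * Real.pi) with hc₀
  have hc₀pos : 0 < c₀ := by positivity
  -- The main term has constant `c₀`; the outer frequencies and the `+ 1` in the majorant each take
  -- at most a quarter of it.
  refine ⟨c₀ / 2, by positivity, ?_⟩
  -- the contribution of frequencies outside the main lobe is negligible
  have hT1 : Tendsto (fun t : ℝ => K * C * (m ^ (-(2 * ϱ))) ^ (-(α * q)) *
      t ^ (-(b * α * q - s))) atTop (𝓝 0) := by
    rw [← mul_zero (K * C * (m ^ (-(2 * ϱ))) ^ (-(α * q)))]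
    exact (tendsto_rpow_neg_atTop (by linarith)).const_mul _
  have hδx : Tendsto (fun t : ℝ => m * t ^ (-(s - β))) atTop (𝓝 0) := by
    rw [← mul_zero m]
    exact (tendsto_rpow_neg_atTop (by linarith [hβ.2])).const_mul _
  have hy1 : Tendsto (fun t : ℝ => m * t ^ β) atTop atTop :=
    (tendsto_rpow_atTop hβ.1).const_mul_atTop hm
  filter_upwards [eventually_ge_atTop 2, hT1.eventually (ge_mem_nhds (by positivity : 0 < c₀ / 4)),
    hδx.eventually (ge_mem_nhds one_pos), hy1.eventually (eventually_ge_atTop 1),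
    (tendsto_rpow_neg_mul_mittagLeffler hα s).eventually (eventually_ge_atTop (4 * K / c₀))]
    with t ht h1 h2 h3 h4 v hv
  have ht0 : 0 < t := by linarith
  have hF : 0 ≤ mittagLeffler α (t ^ α) := mittagLeffler_nonneg hα _
  have hx : |m * t ^ β * v| = m * t ^ β := by
    rw [abs_mul, hv, mul_one, abs_of_pos (by positivity)]
  set X : ℝ := m * t ^ β with hX
  have hX0 : 0 < X := by positivity
  have hts : 0 < t ^ (-s) := by positivity
  -- This `δ` is the frequency at which the symbol equals `1 / t`.
  have hlow := hu.lower_bound hα hϱ (t := t) (x := X * v) (δ := t ^ (-s) / (2 * Real.pi))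
    (by linarith) (by positivity) (by rw [hx]; exact hX0) (by
      rw [hx, div_le_div_iff₀ (by positivity) (by positivity), one_mul]
      have : t ^ (-s) * X ≤ 1 := by
        calc t ^ (-s) * X = m * t ^ (-(s - β)) := by
              rw [hX, neg_sub, sub_eq_add_neg, Real.rpow_add ht0]; ring
          _ ≤ 1 := h2
      calc t ^ (-s) * (2 * Real.pi * X) = 2 * Real.pi * (t ^ (-s) * X) := by ring
        _ ≤ 2 * Real.pi * 1 := by gcongr
        _ = _ := mul_one _)
  rw [hx] at hlow
  have hσ1 : fracSymbol ϱ (t ^ (-s) / (2 * Real.pi)) = 1 / t := by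
    rw [fracSymbol, abs_of_pos (by positivity), mul_div_cancel₀ _ (by positivity),
      ← Real.rpow_mul ht0.le, neg_mul, hsϱ, Real.rpow_neg_one, one_div]
  have hσ2 : fracSymbol ϱ (1 / (2 * Real.pi * X)) = X⁻¹ ^ (2 * ϱ) := by
    rw [fracSymbol, abs_of_pos (by positivity)]
    congr 1
    field_simp
  rw [hσ1, hσ2] at hlow
  set y : ℝ := X⁻¹ ^ (2 * ϱ) with hy
  have hyIoc : y ∈ Ioc (0 : ℝ) 1 :=
    ⟨by positivity, Real.rpow_le_one (by positivity) (inv_le_one_of_one_le₀ h3) (by positivity)⟩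
  have hty : t * y = m ^ (-(2 * ϱ)) * t ^ b := by
    rw [hy, Real.inv_rpow hX0.le, ← Real.rpow_neg hX0.le, hX, Real.mul_rpow hm.le (by positivity),
      ← Real.rpow_mul ht0.le, hb, sub_eq_add_neg, Real.rpow_add ht0, Real.rpow_one]
    ring_nf
  have hup := hCup t ht0 y hyIoc
  have hlow1 := hclow t ht
  rw [mul_comm (t ^ α)] at hup hlow1
  have hKG : K * mittagLeffler α ((1 - y) * t ^ α) ≤
      c₀ / 4 * (t ^ (-s) * mittagLeffler α (t ^ α)) := by
    have e : K * (C * (t * y) ^ (-(α * q))) =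
        (K * C * (m ^ (-(2 * ϱ))) ^ (-(α * q)) * t ^ (-(b * α * q - s))) * t ^ (-s) := by
      rw [hty, Real.mul_rpow (by positivity) (by positivity), ← Real.rpow_mul ht0.le,
        mul_assoc _ _ (t ^ (-s)), ← Real.rpow_add ht0]
      ring_nf
    calc _ ≤ K * (C * (t * y) ^ (-(α * q)) * mittagLeffler α (t ^ α)) := by gcongr
      _ = (K * (C * (t * y) ^ (-(α * q)))) * mittagLeffler α (t ^ α) := by ring
      _ ≤ (c₀ / 4 * t ^ (-s)) * mittagLeffler α (t ^ α) := by
        rw [e]; gcongr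
      _ = _ := by ring
  have hKle : K ≤ c₀ / 4 * (t ^ (-s) * mittagLeffler α (t ^ α)) := by
    rw [div_le_iff₀ hc₀pos] at h4
    linarith
  have hmain : c₀ * (t ^ (-s) * mittagLeffler α (t ^ α)) ≤
      t ^ (-s) / (2 * Real.pi) * mittagLeffler α ((1 - 1 / t) * t ^ α) := by
    calc _ = t ^ (-s) / (2 * Real.pi) * (c * mittagLeffler α (t ^ α)) := by rw [hc₀]; ring
      _ ≤ _ := by gcongr
  linarith

theorem exists_unique_cos_eq_self :
    ∃ ℓ : ℝ, ℓ ∈ Ioo 0 (Real.pi / 2) ∧ Real.cos ℓ = ℓ ∧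
      ∀ ℓ' ∈ Ioo 0 (Real.pi / 2), Real.cos ℓ' = ℓ' → ℓ' = ℓ := by
  have hpi := Real.pi_pos
  have hc : ContinuousOn (fun x => Real.cos x - x) (Icc 0 (Real.pi / 2)) := by fun_prop
  obtain ⟨ℓ, hℓ, h0⟩ := intermediate_value_Ioo' (by positivity) hc
    (show (0 : ℝ) ∈ Ioo _ _ by constructor <;> simp [hpi])
  refine ⟨ℓ, hℓ, sub_eq_zero.1 h0, fun ℓ' hℓ' h' => ?_⟩
  have hcos : Real.cos ℓ = ℓ := sub_eq_zero.1 h0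
  rcases lt_trichotomy ℓ' ℓ with h | h | h
  · have := Real.cos_lt_cos_of_nonneg_of_le_pi_div_two hℓ'.1.le hℓ.2.le h
    linarith
  · exact h
  · have := Real.cos_lt_cos_of_nonneg_of_le_pi_div_two hℓ.1.le hℓ'.2.le h
    linarith

end

theorem theorem1p5 (α ϱ β m : ℝ) (hα : α ∈ Ioo (0 : ℝ) 1) (hϱ : 1 ≤ ϱ)
    (hβ : β ∈ Ioo (0 : ℝ) (1 / (2 * ϱ))) (hm : 0 < m)
    (u : ℝ → ℝ → ℝ) (hu : IsFundamentalSolution α ϱ u) :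
    ∃ ℓ : ℝ, (ℓ ∈ Ioo 0 (Real.pi / 2) ∧ Real.cos ℓ = ℓ ∧
        ∀ ℓ' ∈ Ioo 0 (Real.pi / 2), Real.cos ℓ' = ℓ' → ℓ' = ℓ) ∧
      ∀ v : ℝ, |v| = 1 →
        (∀ n : ℕ, 2 ≤ n → 1 / (n : ℝ) ≤ α →
          ∃ ε : ℝ → ℝ, Tendsto ε atTop (𝓝 0) ∧ ∀ t : ℝ, 0 < t →
            α * ℓ ^ (2 - 2 * ϱ) / (2 * ϱ) * m ^ (2 * ϱ - 1) *
                t ^ (β * (2 * ϱ - 1) - α * n) * mittagLeffler α (t ^ α) * (1 - ε t) <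
              u t (m * t ^ β * v)) ∧
        Tendsto (fun t : ℝ => u t (m * t ^ β * v)) atTop atTop := by
  obtain ⟨ℓ, hℓ⟩ := exists_unique_cos_eq_self
  obtain ⟨c, hc, hlow⟩ := hu.exists_eventually_le hα hϱ hβ hm
  refine ⟨ℓ, hℓ, fun v hv => ⟨fun n hn hnα => ?_, ?_⟩⟩
  · have hα0 := hα.1
    have hϱ0 : 0 < ϱ := by linarith
    have hℓ0 := hℓ.1.1
    set A : ℝ := α * ℓ ^ (2 - 2 * ϱ) / (2 * ϱ) * m ^ (2 * ϱ - 1) with hA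
    have hA0 : 0 < A := by positivity
    set e : ℝ := β * (2 * ϱ - 1) - α * n with he
    -- From `αn ≥ 1` and `β(2ϱ - 1) < 1 - 1/(2ϱ)`. The strict gap lets a power of `t` absorb `A`, of
    -- which only positivity matters.
    have hes : 0 < -(1 / (2 * ϱ)) - e := by
      have hn0 : (0 : ℝ) < n := by positivity
      have h1 : 1 ≤ α * n := by rwa [div_le_iff₀ hn0] at hnα
      have h2 : β * (2 * ϱ - 1) < 1 / (2 * ϱ) * (2 * ϱ - 1) :=
        mul_lt_mul_of_pos_right hβ.2 (by linarith)
      have h3 : 1 / (2 * ϱ) * (2 * ϱ - 1) = 1 - 1 / (2 * ϱ) := by field_simp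
      linarith
    have hFpos : ∀ t : ℝ, 0 < t → 0 < mittagLeffler α (t ^ α) := fun t ht =>
      zero_lt_one.trans_le (one_le_mittagLeffler hα (by positivity))
    have hlim : Tendsto (fun t : ℝ => A * t ^ (-(-(1 / (2 * ϱ)) - e))) atTop (𝓝 0) := by
      rw [← mul_zero A]
      exact (tendsto_rpow_neg_atTop hes).const_mul A
    have hev : ∀ᶠ t in atTop,
        A * t ^ e * mittagLeffler α (t ^ α) < u t (m * t ^ β * v) := by
      filter_upwards [hlow, hlim.eventually (gt_mem_nhds hc), eventually_gt_atTop 0]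
        with t h1 h2 ht
      refine lt_of_lt_of_le ?_ (h1 v hv)
      have h3 : t ^ e = t ^ (-(-(1 / (2 * ϱ)) - e)) * t ^ (-(1 / (2 * ϱ))) := by
        rw [← Real.rpow_add ht]
        ring_nf
      rw [h3, ← mul_assoc A, mul_assoc _ (t ^ (-(1 / (2 * ϱ))))]
      have := hFpos t ht
      gcongr
    classical
    -- The inequality is required for every `t > 0`. Where it fails with `ε = 0`, which happens only
    -- for bounded `t`, `ε` is chosen to make the left side equal `u - 1`.
    refine ⟨fun t => if A * t ^ e * mittagLeffler α (t ^ α) < u t (m * t ^ β * v) then 0 else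
      1 - (u t (m * t ^ β * v) - 1) / (A * t ^ e * mittagLeffler α (t ^ α)), ?_, fun t ht => ?_⟩
    · refine tendsto_const_nhds.congr' ?_
      filter_upwards [hev] with t h
      rw [if_pos h]
    · have hP : 0 < A * t ^ e * mittagLeffler α (t ^ α) := by
        have := hFpos t ht
        positivity
      dsimp only
      split_ifs with h
      · rwa [sub_zero, mul_one]
      · rw [sub_sub_cancel, mul_div_cancel₀ _ hP.ne']
        linarith
  · refine tendsto_atTop_mono' _ ?_
      ((tendsto_rpow_neg_mul_mittagLeffler hα (1 / (2 * ϱ))).const_mul_atTop hc)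
    filter_upwards [hlow] with t h using h v hv
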